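/- Let $n\ge 3$, $\alpha\in(0,1)$ and $\tau\in(n/2,n)$. Represent hyperbolic space $\mathbb H^n$ as the unit ball with the metric $b=\rho^{-2}\delta$, $\rho=(1-|x|^2)/2$. For an integer $k\ge 0$, $\beta\in[0,1)$, $\sigma\ge 0$ and an open set $\Omega\subset\mathbb H^n$, a tensor field $T$ is in $C^{k,\beta}_\sigma(\Omega)$ if it is $C^k$ on $\Omega$ and $\sup_x \rho(x)^{-\sigma}\|T\|_{C^{k,\beta}(B_1(x))}<\infty$, the supremum being over the geodesic unit balls $B_1(x)\subset\Omega$ and the Hölder norms being taken with respect to $b$. Let $M$ be a smooth $n$-manifold (possibly with boundary) with a Riemannian metric $g$ of class $C^{1,\alpha}_{loc}$ and a symmetric $2$-tensor $K$ of class $C^{0,\alpha}_{loc}$, which is $C^{1,\alpha}_\tau$ asymptotically anti-de Sitter: there are a compact set $K_0\subset M$, a radius $R_0>0$ and a diffeomorphism $\Psi:M\setminus K_0\to\mathbb H^n\setminus\overline{B_{R_0}}$ with $\Psi_*g-b\in C^{1,\alpha}_\tau$ and $\Psi_*K\in C^{0,\alpha}_\tau$ on $\mathbb H^n\setminus\overline{B_{R_0}}$.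 Write $\rho$ also for $\rho\circ\Psi$, and identify functions on $M\setminus K_0$ with functions on $\mathbb H^n\setminus\overline{B_{R_0}}$ by $\Psi$. Let $u:M\to\mathbb R$ satisfy $u-\rho^{-1}\in C^{1,0}_0(\{\rho<r\})$ for some $r>0$ with $\{\rho<r\}\subset \mathbb H^n\setminus\overline{B_{R_0}}$, and let $$\mathcal J(f)=\Big(g^{ij}-\frac{u^2f^if^j}{1+u^2|df|_g^2}\Big)\Big(\frac{u\,\mathrm{Hess}_{ij}f+u_if_j+f_iu_j}{\sqrt{1+u^2|df|_g^2}}-K_{ij}\Big)$$ be the generalized Jang operator. Then there are $\lambda\in(0,1)$ and $r_1\in(0,r]$ such that for every $\rho_0\in(0,r_1)$ the radial function $$f_+=\int_0^{\rho}\frac{\xi_+(s)}{\sqrt{1-\xi_+(s)^2}}\,ds,\qquad \xi_+(s)=\frac{1}{(1-\lambda)(\rho_0/s)^{n/2}+\lambda(\rho_0/s)^{\tau}},$$ on $\{\rho\le\rho_0\}$ has the following properties. It is positive; it is $C^2$ on $\{\rho<\rho_0\}$ and continuous on $\{\rho\le\rho_0\}$; it belongs to $C^{2,\alpha}_{\tau+1}(\{\rho<r'\})$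 for every $r'\in(0,\rho_0)$; it satisfies $\mathcal J(f_+)<0$ on $\{\rho<\rho_0\}$; and $\partial_\rho f_+\to\infty$ as $\rho\to\rho_0^-$, uniformly in the angular variables. That is, $f_+$ is an upper barrier. The function $f_-=-f_+$ is a lower barrier: it is $C^2$ on $\{\rho<\rho_0\}$ and continuous on $\{\rho\le\rho_0\}$, $\mathcal J(f_-)>0$ on $\{\rho<\rho_0\}$, and $\partial_\rho f_-\to-\infty$ as $\rho\to\rho_0^-$. -/

import Mathlib

open Set Filter Topology Manifold
open scoped ContDiff

/-! ### The Poincaré ball model of hyperbolic space -/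

/-- Euclidean `n`-space; the Poincaré ball is its open unit ball. -/
abbrev Euc (n : ℕ) : Type := EuclideanSpace ℝ (Fin n)

/-- The function `ρ = (1 - |x|²) / 2`. -/
noncomputable def ballRho {n : ℕ} (x : Euc n) : ℝ := (1 - ‖x‖ ^ 2) / 2

/-- The hyperbolic metric `b = ρ⁻² δ = 4 (1 - |x|²)⁻² δ`. -/
noncomputable def hypMetric {n : ℕ} (x : Euc n) : Euc n →L[ℝ] Euc n →L[ℝ] ℝ :=
  (ballRho x ^ 2)⁻¹ • (innerSL ℝ : Euc n →L[ℝ] Euc n →L[ℝ] ℝ)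

/-- The geodesic distance of `b`, from `sinh² (d/2) = |x - y|² / (4 ρ(x) ρ(y))`
(meaningful for points of the open unit ball). -/
noncomputable def hypDist {n : ℕ} (x y : Euc n) : ℝ :=
  2 * Real.arsinh (dist x y / (2 * √(ballRho x * ballRho y)))

/-- The geodesic ball `B_r(x)` of hyperbolic space. -/
def hypBall {n : ℕ} (x : Euc n) (r : ℝ) : Set (Euc n) :=
  {y | ‖y‖ < 1 ∧ hypDist x y < r}

/-- The complement in hyperbolic space of the closed geodesic ball of radius `R` about the
origin. -/
def hypExterior (n : ℕ) (R : ℝ) : Set (Euc n) :=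
  {x | ‖x‖ < 1 ∧ R < hypDist 0 x}

/-- The region `{ρ < r}` of hyperbolic space. -/
def rhoLT (n : ℕ) (r : ℝ) : Set (Euc n) := {x | ‖x‖ < 1 ∧ ballRho x < r}

/-- The region `{ρ ≤ r}` of hyperbolic space. -/
def rhoLE (n : ℕ) (r : ℝ) : Set (Euc n) := {x | ‖x‖ < 1 ∧ ballRho x ≤ r}

/-- The coordinate derivative `∂_ρ h` in polar coordinates `(ρ, θ)`, where `x = √(1 - 2ρ) θ`,
so that `∂_ρ = - |x|⁻² x`. -/
noncomputable def rhoDeriv {n : ℕ} (h : Euc n → ℝ) (x : Euc n) : ℝ :=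
  fderiv ℝ h x (-(‖x‖ ^ 2)⁻¹ • x)

/-! ### Hölder regularity -/

/-- `T` (the components of a covariant tensor field of rank `m`; `m = 0` for functions) is of
class `C^{k,α}_τ` on the open subset `Ω` of hyperbolic space: it is `C^k` on `Ω` and
`sup_x ρ(x)^{-τ} ‖T‖_{C^{k,α}(B_1(x))} < ∞`, the supremum over all `x` whose geodesic unit ball
`B_1(x)` lies in `Ω`.  The norm over `B_1(x)` is taken in the coordinates `(y - x)/ρ(x)`, in which
`b` is uniformly equivalent to the Euclidean metric, with uniform bounds on all derivatives;
the components of a rank `m` tensor then acquire the factor `ρ(x)^m`, each derivative a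
factor `ρ(x)`, and the Hölder seminorm a factor `ρ(x)^α`. -/
def IsWeightedHolder {n : ℕ} {F : Type*} [NormedAddCommGroup F] [NormedSpace ℝ F]
    (m k : ℕ) (α τ : ℝ) (Ω : Set (Euc n)) (T : Euc n → F) : Prop :=
  ContDiffOn ℝ k T Ω ∧
  ∃ C : ℝ, ∀ x : Euc n, ‖x‖ < 1 → hypBall x 1 ⊆ Ω →
    (∀ j ≤ k, ∀ y ∈ hypBall x 1,
      ballRho x ^ (m + j) * ‖iteratedFDeriv ℝ j T y‖ ≤ C * ballRho x ^ τ) ∧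
    (∀ y ∈ hypBall x 1, ∀ z ∈ hypBall x 1,
      ballRho x ^ ((m : ℝ) + k + α) * ‖iteratedFDeriv ℝ k T y - iteratedFDeriv ℝ k T z‖
        ≤ C * ballRho x ^ τ * dist y z ^ α)

/-- `h` is of class `C^{k,α}_loc` on the set `S` (which is a set of unique differentiability
in the uses below). -/
def IsLocHolderOn {n : ℕ} {F : Type*} [NormedAddCommGroup F] [NormedSpace ℝ F]
    (k : ℕ) (α : ℝ) (S : Set (Euc n)) (h : Euc n → F) : Prop :=
  ContDiffOn ℝ k h S ∧
  ∀ y ∈ S, ∃ V ∈ 𝓝[S] y, ∃ C : ℝ, ∀ z ∈ V ∩ S, ∀ w ∈ V ∩ S,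
    ‖iteratedFDerivWithin ℝ k h S z - iteratedFDerivWithin ℝ k h S w‖ ≤ C * dist z w ^ α

/-! ### Asymptotically anti-de Sitter initial data sets -/

section Manifold

variable {n : ℕ} {H : Type*} [TopologicalSpace H] (I : ModelWithCorners ℝ (Euc n) H)
  (M : Type*) [TopologicalSpace M] [ChartedSpace H M]

/-- Fields of bilinear forms (covariant 2-tensors) on `M`, without regularity. -/
abbrev BilinField : Type _ :=
  ∀ p : M, TangentSpace I p →L[ℝ] TangentSpace I p →L[ℝ] ℝ

variable {I M}

/-- The 2-tensor field `T` is of class `C^{k,α}_loc` on `M`: its components in the charts of `M`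
are. -/
def BilinField.IsLocHolder (k : ℕ) (α : ℝ) (T : BilinField I M) : Prop :=
  ∀ p : M, IsLocHolderOn k α (extChartAt I p).target
    (fun y : Euc n =>
      let D : Euc n →L[ℝ] Euc n :=
        mfderivWithin 𝓘(ℝ, Euc n) I (extChartAt I p).symm (range I) y
      (show Euc n →L[ℝ] Euc n →L[ℝ] ℝ from T ((extChartAt I p).symm y)).bilinearComp D D)

/-- `(M, g, K)` is a `C^{k,α}` initial data set (`k ≥ 1`): `g` is a Riemannian metric of class
`C^{k,α}_loc` and `K` is a symmetric 2-tensor of class `C^{k-1,α}_loc`. -/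
structure IsInitialDataSet (k : ℕ) (α : ℝ) (g K : BilinField I M) : Prop where
  symm : ∀ (p : M) (v w : TangentSpace I p), g p v w = g p w v
  pos : ∀ (p : M) (v : TangentSpace I p), v ≠ 0 → 0 < g p v v
  holder : g.IsLocHolder k α
  symm_K : ∀ (p : M) (v w : TangentSpace I p), K p v w = K p w v
  holder_K : K.IsLocHolder (k - 1) α

variable (I M) in
/-- A chart at infinity: a diffeomorphism `Ψ` from the complement of a compact set `K₀` onto the
complement of a closed ball of radius `R₀` in hyperbolic space. -/
structure ChartAtInfinity where
  K₀ : Set M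
  isCompact_K₀ : IsCompact K₀
  R₀ : ℝ
  R₀_pos : 0 < R₀
  Ψ : OpenPartialHomeomorph M (Euc n)
  source_eq : Ψ.source = K₀ᶜ
  target_eq : Ψ.target = hypExterior n R₀
  smooth : ContMDiffOn I 𝓘(ℝ, Euc n) ∞ Ψ Ψ.source
  smooth_symm : ContMDiffOn 𝓘(ℝ, Euc n) I ∞ Ψ.symm Ψ.target

namespace ChartAtInfinity

variable (c : ChartAtInfinity I M)

/-- The push-forward `Ψ_* T` of a 2-tensor field (meaningful on `Ψ.target`). -/
noncomputable def push (T : BilinField I M) (x : Euc n) : Euc n →L[ℝ] Euc n →L[ℝ] ℝ :=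
  let D : Euc n →L[ℝ] Euc n := mfderiv 𝓘(ℝ, Euc n) I c.Ψ.symm x
  (show Euc n →L[ℝ] Euc n →L[ℝ] ℝ from T (c.Ψ.symm x)).bilinearComp D D

/-- The region `{ρ < r}` of `M`. -/
def region (r : ℝ) : Set M := {p | p ∈ c.Ψ.source ∧ ballRho (c.Ψ p) < r}

/-- The region `{ρ ≤ r}` of `M`. -/
def closedRegion (r : ℝ) : Set M := {p | p ∈ c.Ψ.source ∧ ballRho (c.Ψ p) ≤ r}

/-- `h : M → ℝ` is of class `C^{k,α}_τ` on the region `{ρ < r}`. -/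
def IsWeightedHolderFun (k : ℕ) (α τ r : ℝ) (h : M → ℝ) : Prop :=
  IsWeightedHolder 0 k α τ (rhoLT n r) (fun x => h (c.Ψ.symm x))

end ChartAtInfinity

/-- `(M, g, K)` is a `C^{k,α}_τ` asymptotically anti-de Sitter initial data set with respect to
the chart at infinity `c`. -/
structure IsAsympAdS (k : ℕ) (α τ : ℝ) (g K : BilinField I M) (c : ChartAtInfinity I M) :
    Prop extends IsInitialDataSet k α g K where
  decay_g : IsWeightedHolder 2 k α τ c.Ψ.target (fun x => c.push g x - hypMetric x)
  decay_K : IsWeightedHolder 2 (k - 1) α τ c.Ψ.target (c.push K)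

end Manifold

/-! ### The generalized Jang operator -/

section Coordinates

variable {n : ℕ}

/-- The partial derivative `∂_i h`. -/
noncomputable def pderiv (i : Fin n) (h : Euc n → ℝ) (x : Euc n) : ℝ :=
  fderiv ℝ h x (EuclideanSpace.single i 1)

/-- The components `T_{ij}` of a field of bilinear forms. -/
noncomputable def comp₂ (T : Euc n → Euc n →L[ℝ] Euc n →L[ℝ] ℝ) (x : Euc n) :
    Matrix (Fin n) (Fin n) ℝ :=
  Matrix.of fun i j => T x (EuclideanSpace.single i 1) (EuclideanSpace.single j 1)

/-- The components `g^{ij}` of the inverse metric. -/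
noncomputable def invMetric (g : Euc n → Euc n →L[ℝ] Euc n →L[ℝ] ℝ) (x : Euc n) :
    Matrix (Fin n) (Fin n) ℝ := (comp₂ g x)⁻¹

/-- The Christoffel symbol `Γ^k_{ij}` of `g`. -/
noncomputable def christoffel (g : Euc n → Euc n →L[ℝ] Euc n →L[ℝ] ℝ) (k i j : Fin n)
    (x : Euc n) : ℝ :=
  (1 / 2) * ∑ l, invMetric g x k l *
    (pderiv i (fun y => comp₂ g y j l) x + pderiv j (fun y => comp₂ g y i l) x
      - pderiv l (fun y => comp₂ g y i j) x)

/-- The components `Hess_{ij} f` of the Hessian of `f` with respect to `g`. -/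
noncomputable def hessComp (g : Euc n → Euc n →L[ℝ] Euc n →L[ℝ] ℝ) (f : Euc n → ℝ)
    (i j : Fin n) (x : Euc n) : ℝ :=
  pderiv i (pderiv j f) x - ∑ k, christoffel g k i j x * pderiv k f x

/-- `f^i = g^{ij} f_j`. -/
noncomputable def gradComp (g : Euc n → Euc n →L[ℝ] Euc n →L[ℝ] ℝ) (f : Euc n → ℝ)
    (i : Fin n) (x : Euc n) : ℝ :=
  ∑ j, invMetric g x i j * pderiv j f x

/-- `|df|²_g = f^i f_i`. -/
noncomputable def gradSq (g : Euc n → Euc n →L[ℝ] Euc n →L[ℝ] ℝ) (f : Euc n → ℝ)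
    (x : Euc n) : ℝ :=
  ∑ i, gradComp g f i x * pderiv i f x

/-- The generalized Jang operator in coordinates,
`(g^{ij} - u² f^i f^j / (1 + u²|df|²))
  ((u Hess_{ij} f + u_i f_j + f_i u_j) / √(1 + u²|df|²) - K_{ij})`. -/
noncomputable def coordJang (g K : Euc n → Euc n →L[ℝ] Euc n →L[ℝ] ℝ) (u f : Euc n → ℝ)
    (x : Euc n) : ℝ :=
  ∑ i, ∑ j,
    (invMetric g x i j
      - u x ^ 2 * gradComp g f i x * gradComp g f j x / (1 + u x ^ 2 * gradSq g f x)) *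
    ((u x * hessComp g f i j x + pderiv i u x * pderiv j f x + pderiv i f x * pderiv j u x)
        / √(1 + u x ^ 2 * gradSq g f x)
      - comp₂ K x i j)

end Coordinates

section Barriers

variable {n : ℕ} {H : Type*} [TopologicalSpace H] {I : ModelWithCorners ℝ (Euc n) H}
  {M : Type*} [TopologicalSpace M] [ChartedSpace H M]

/-- The generalized Jang operator `J(f)` at a point `p` of the end of `M`, in the coordinates
provided by the chart at infinity (the value does not depend on the coordinates). -/
noncomputable def jangOperator (c : ChartAtInfinity I M) (g K : BilinField I M) (u f : M → ℝ)
    (p : M) : ℝ :=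
  coordJang (c.push g) (c.push K) (fun x => u (c.Ψ.symm x)) (fun x => f (c.Ψ.symm x)) (c.Ψ p)

/-- `f` is an upper barrier on `{ρ < ρ₀}` for the generalized Jang equation. -/
structure IsUpperBarrier (c : ChartAtInfinity I M) (g K : BilinField I M) (u : M → ℝ) (ρ₀ : ℝ)
    (f : M → ℝ) : Prop where
  contMDiffOn : ContMDiffOn I 𝓘(ℝ, ℝ) 2 f (c.region ρ₀)
  continuousOn : ContinuousOn f (c.closedRegion ρ₀)
  tendsto : Tendsto (rhoDeriv fun x => f (c.Ψ.symm x)) (comap ballRho (𝓝[<] ρ₀)) atTop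
  jang_neg : ∀ p ∈ c.region ρ₀, jangOperator c g K u f p < 0

/-- `f` is a lower barrier on `{ρ < ρ₀}` for the generalized Jang equation. -/
structure IsLowerBarrier (c : ChartAtInfinity I M) (g K : BilinField I M) (u : M → ℝ) (ρ₀ : ℝ)
    (f : M → ℝ) : Prop where
  contMDiffOn : ContMDiffOn I 𝓘(ℝ, ℝ) 2 f (c.region ρ₀)
  continuousOn : ContinuousOn f (c.closedRegion ρ₀)
  tendsto : Tendsto (rhoDeriv fun x => f (c.Ψ.symm x)) (comap ballRho (𝓝[<] ρ₀)) atBot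
  jang_pos : ∀ p ∈ c.region ρ₀, 0 < jangOperator c g K u f p

end Barriers

/-- The ansatz `ξ₊(s) = 1 / ((1 - λ) (ρ₀/s)^{n/2} + λ (ρ₀/s)^τ)`, with `l` for `λ`. -/
noncomputable def xiPlus (n : ℕ) (τ l ρ₀ s : ℝ) : ℝ :=
  1 / ((1 - l) * (ρ₀ / s) ^ ((n : ℝ) / 2) + l * (ρ₀ / s) ^ τ)

set_option maxSynthPendingDepth 3

/-! ### Geometry of the ball model -/

section BallGeometry

variable {n : ℕ}

/-! Write the radial function as `φ(ρ)` with slope `p = φ' = ξ/√(1-ξ²)`, so that `ξ = p/√(1+p²)`.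
For `g = b`, `u = 1/ρ`, `K = 0` the leading part of the Jang operator at infinity is `ρξ' - nξ + ξ³
= ξ (z - n + ξ²)` with `z = ρξ'/ξ`, and everything rests on the sign of this bracket.

The ansatz makes `D = 1/ξ` a convex combination of `(ρ₀/s)^(n/2)` and `(ρ₀/s)^τ`. Hence `z = (1-w)
n/2 + w τ`, where `w` is the share of the `τ`-power in `D`. The `τ`-share has room because `τ < n`.
The `n/2`-share leaves a reserve `(1-w) n/2`, which accommodates `ξ²` since `ξ² ≤ ξ ≤ (1-w)/(1-λ)`
and `1/(1-λ) < n/2` for `λ = 1/4`, `n ≥ 3`. So the bracket is bounded above by a negative constant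
on all of `(0, ρ₀)` (`xiDen_ratio_bound`).

For actual data, the errors of metric and lapse change the bracket by `o(1)`, uniformly in `p`,
because the coefficient matrix stays bounded however large `p` is. The `K`-term is `O(ρ^τ)`; since
`ξ ≥ (ρ/ρ₀)^τ`, it is at most a constant times `ρ₀^τ ξ` and is absorbed when `ρ₀` is small. In
`eventually_coordJang_neg` the neighbourhood of infinity is fixed before the slope, so that one `r₁`
serves every `ρ₀`.

At `ρ₀` the value `ξ = 1` makes the slope blow up, but no faster than `(ρ₀-s)^(-1/2)`, which is
integrable; this gives continuity up to `ρ₀`. At infinity `1/D = O(s^τ)` controls the slope and its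
scaled derivatives, which gives the weight `τ + 1`. The lower barrier follows from the upper one
with `-K` in place of `K` (`coordJang_neg`). -/

theorem ballRho_pos_iff {x : Euc n} : 0 < ballRho x ↔ ‖x‖ < 1 := by
  unfold ballRho
  rw [div_pos_iff_of_pos_right two_pos, sub_pos, sq_lt_one_iff₀ (norm_nonneg x)]

theorem ballRho_le_half (x : Euc n) : ballRho x ≤ 1 / 2 := by
  unfold ballRho; nlinarith [sq_nonneg ‖x‖]

theorem norm_sq_eq_one_sub_ballRho (x : Euc n) : ‖x‖ ^ 2 = 1 - 2 * ballRho x := by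
  unfold ballRho; ring

theorem continuous_ballRho : Continuous (ballRho : Euc n → ℝ) := by
  unfold ballRho; fun_prop

theorem contDiff_ballRho {k : WithTop ℕ∞} : ContDiff ℝ k (ballRho : Euc n → ℝ) := by
  unfold ballRho
  exact (contDiff_const.sub (contDiff_norm_sq ℝ)).div_const _

theorem hasFDerivAt_ballRho (x : Euc n) :
    HasFDerivAt (ballRho : Euc n → ℝ) (-(innerSL ℝ x)) x := by
  have h := ((hasStrictFDerivAt_norm_sq x).hasFDerivAt.const_sub (1 : ℝ)).mul_const (1 / 2 : ℝ)
  have e : (fun y : Euc n => (1 - ‖y‖ ^ 2) * (1 / 2 : ℝ)) = ballRho := by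
    funext y; simp [ballRho, div_eq_mul_inv]
  rw [e] at h
  refine h.congr_fderiv ?_
  ext v
  simp

theorem isOpen_rhoLT (r : ℝ) : IsOpen (rhoLT n r) :=
  (isOpen_lt continuous_norm continuous_const).inter
    (isOpen_lt continuous_ballRho continuous_const)

theorem abs_ballRho_sub_le {x y : Euc n} (hx : ‖x‖ < 1) (hy : ‖y‖ < 1) :
    |ballRho x - ballRho y| ≤ dist x y := by
  have h1 : |‖y‖ - ‖x‖| ≤ dist x y := by
    rw [dist_comm, dist_eq_norm]; exact abs_norm_sub_norm_le y x
  have e : ballRho x - ballRho y = (‖y‖ - ‖x‖) * ((‖y‖ + ‖x‖) / 2) := by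
    unfold ballRho; ring
  have h2 : |(‖y‖ + ‖x‖) / 2| ≤ 1 := by
    rw [abs_of_nonneg (by positivity)]; linarith
  rw [e, abs_mul]
  calc _ ≤ dist x y * 1 := mul_le_mul h1 h2 (abs_nonneg _) dist_nonneg
    _ = _ := mul_one _

theorem mem_hypBall_self {x : Euc n} (hx : ‖x‖ < 1) : x ∈ hypBall x 1 := by
  refine ⟨hx, ?_⟩
  simp [hypDist]

theorem dist_le_of_mem_hypBall {x y : Euc n} (hx : ‖x‖ < 1) (hy : y ∈ hypBall x 1) :
    dist x y ≤ 2 * Real.sinh (1 / 2) * √(ballRho x * ballRho y) := by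
  obtain ⟨hy1, hy2⟩ := hy
  have hp : 0 < √(ballRho x * ballRho y) :=
    Real.sqrt_pos.2 (mul_pos (ballRho_pos_iff.2 hx) (ballRho_pos_iff.2 hy1))
  unfold hypDist at hy2
  have h3 : Real.arsinh (dist x y / (2 * √(ballRho x * ballRho y))) < 1 / 2 := by linarith
  have h4 := Real.sinh_lt_sinh.2 h3
  rw [Real.sinh_arsinh, div_lt_iff₀ (by positivity)] at h4
  linarith

/-- With `a = √s`, `b = √t`, `E = e^(1/2)`, the hypotheses give `a² - b² ≤ (E - E⁻¹)ab`, that is `(a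
- Eb)(a + E⁻¹b) ≤ 0`, so `a ≤ Eb`. This is the Harnack-type comparability of `ρ` on unit balls. -/
theorem ballRho_le_exp_mul_of_dist_le {s t d : ℝ} (hs : 0 < s) (ht : 0 < t)
    (h : |s - t| ≤ d) (hd : d ≤ 2 * Real.sinh (1 / 2) * √(s * t)) : s ≤ Real.exp 1 * t := by
  by_contra! hlt
  set a := √s
  set b := √t
  have ha : a ^ 2 = s := Real.sq_sqrt hs.le
  have hb : b ^ 2 = t := Real.sq_sqrt ht.le
  have ha0 : 0 < a := Real.sqrt_pos.2 hs
  have hb0 : 0 < b := Real.sqrt_pos.2 ht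
  rw [Real.sqrt_mul hs.le] at hd
  set E := Real.exp (1 / 2)
  have hE : Real.exp 1 = E ^ 2 := by rw [← Real.exp_nat_mul]; norm_num
  have hE0 : 0 < E := Real.exp_pos _
  have hsinh : 2 * Real.sinh (1 / 2) = E - E⁻¹ := by rw [Real.sinh_eq, Real.exp_neg]; ring
  have h1 : a ^ 2 - b ^ 2 ≤ (E - E⁻¹) * (a * b) := by
    rw [ha, hb, ← hsinh]; exact (le_abs_self _).trans (h.trans hd)
  have h2 : E * b < a := by
    refine lt_of_pow_lt_pow_left₀ 2 ha0.le ?_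
    rw [mul_pow, hb, ha, ← hE]; exact hlt
  have h3 : (a - E * b) * (a + E⁻¹ * b) ≤ 0 := by
    have : (a - E * b) * (a + E⁻¹ * b) = a ^ 2 - (E - E⁻¹) * (a * b) - b ^ 2 * (E * E⁻¹) := by ring
    rw [this, mul_inv_cancel₀ hE0.ne']; linarith
  have h4 : 0 < (a - E * b) * (a + E⁻¹ * b) := mul_pos (by linarith) (by positivity)
  linarith

theorem ballRho_le_of_mem_hypBall {x y : Euc n} (hx : ‖x‖ < 1) (hy : y ∈ hypBall x 1) :
    ballRho y ≤ Real.exp 1 * ballRho x := by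
  refine ballRho_le_exp_mul_of_dist_le (ballRho_pos_iff.2 hy.1) (ballRho_pos_iff.2 hx)
    (abs_ballRho_sub_le hy.1 hx) ?_
  rw [dist_comm, mul_comm (ballRho y)]; exact dist_le_of_mem_hypBall hx hy

theorem ballRho_le_of_mem_hypBall' {x y : Euc n} (hx : ‖x‖ < 1) (hy : y ∈ hypBall x 1) :
    ballRho x ≤ Real.exp 1 * ballRho y :=
  ballRho_le_exp_mul_of_dist_le (ballRho_pos_iff.2 hx) (ballRho_pos_iff.2 hy.1)
    (abs_ballRho_sub_le hx hy.1) (dist_le_of_mem_hypBall hx hy)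

/-- Geodesic unit balls have Euclidean diameter comparable to `ρ`. -/
theorem exists_dist_le_mul_ballRho (n : ℕ) : ∃ C > 0, ∀ x : Euc n, ‖x‖ < 1 →
    ∀ y ∈ hypBall x 1, ∀ z ∈ hypBall x 1, dist y z ≤ C * ballRho x := by
  have hs : 0 < Real.sinh (1 / 2) := Real.sinh_pos_iff.2 (by norm_num)
  have key : ∀ x : Euc n, ‖x‖ < 1 → ∀ y ∈ hypBall x 1,
      dist x y ≤ 2 * Real.sinh (1 / 2) * √(Real.exp 1) * ballRho x := by
    intro x hx y hy
    have hx0 := ballRho_pos_iff.2 hx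
    refine (dist_le_of_mem_hypBall hx hy).trans ?_
    rw [mul_assoc _ (√_)]
    gcongr
    rw [← Real.sqrt_sq hx0.le, ← Real.sqrt_mul (Real.exp_pos _).le, Real.sqrt_sq hx0.le]
    apply Real.sqrt_le_sqrt
    nlinarith [ballRho_le_of_mem_hypBall hx hy]
  refine ⟨2 * (2 * Real.sinh (1 / 2) * √(Real.exp 1)), by positivity, fun x hx y hy z hz => ?_⟩
  have := dist_triangle_left y z x
  linarith [key x hx y hy, key x hx z hz]

theorem hypBall_subset_rhoLT {x : Euc n} {r : ℝ} (hx : ‖x‖ < 1)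
    (h : Real.exp 1 * ballRho x < r) : hypBall x 1 ⊆ rhoLT n r :=
  fun _ hy => ⟨hy.1, (ballRho_le_of_mem_hypBall hx hy).trans_lt h⟩

/-! ### The end of the ball -/

/-- The filter of neighbourhoods of the sphere at infinity in the ball. -/
noncomputable def sphereAtInfinity (n : ℕ) : Filter (Euc n) := comap ballRho (𝓝[>] 0)

theorem tendsto_ballRho_sphereAtInfinity :
    Tendsto (ballRho : Euc n → ℝ) (sphereAtInfinity n) (𝓝[>] 0) := tendsto_comap

theorem eventually_sphereAtInfinity_iff {P : Euc n → Prop} :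
    (∀ᶠ x in sphereAtInfinity n, P x) ↔
      ∃ r > 0, ∀ x, 0 < ballRho x → ballRho x < r → P x := by
  unfold sphereAtInfinity
  rw [((nhdsGT_basis (0 : ℝ)).comap ballRho).eventually_iff]
  simp [and_imp]

theorem eventually_mem_rhoLT {r : ℝ} (hr : 0 < r) :
    ∀ᶠ x in sphereAtInfinity n, x ∈ rhoLT n r :=
  eventually_sphereAtInfinity_iff.2 ⟨r, hr, fun _ h h' => ⟨ballRho_pos_iff.1 h, h'⟩⟩

theorem eventually_ballRho_pos : ∀ᶠ x in sphereAtInfinity n, 0 < ballRho x :=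
  eventually_sphereAtInfinity_iff.2 ⟨1, one_pos, fun _ h _ => h⟩

/-- Near infinity the whole ball `B₁(x)` lies in `{ρ < r}`, because `ρ` grows by at most a factor
`e` on it; the weighted bound is then read off at the centre. -/
theorem IsWeightedHolder.eventually_le {F : Type*} [NormedAddCommGroup F] [NormedSpace ℝ F]
    {m k : ℕ} {α τ r : ℝ} {Ω : Set (Euc n)} {T : Euc n → F}
    (h : IsWeightedHolder m k α τ Ω T) (hr : 0 < r) (hΩ : rhoLT n r ⊆ Ω) :
    ∃ C > 0, ∀ j ≤ k, ∀ᶠ x in sphereAtInfinity n,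
      ballRho x ^ (m + j) * ‖iteratedFDeriv ℝ j T x‖ ≤ C * ballRho x ^ τ := by
  obtain ⟨-, C, hC⟩ := h
  refine ⟨max C 1, by positivity, fun j hj => eventually_sphereAtInfinity_iff.2
    ⟨r / Real.exp 1, by positivity, fun x hx hxr => ?_⟩⟩
  have hx1 := ballRho_pos_iff.1 hx
  rw [lt_div_iff₀' (Real.exp_pos 1)] at hxr
  refine ((hC x hx1 ((hypBall_subset_rhoLT hx1 hxr).trans hΩ)).1 j hj x
    (mem_hypBall_self hx1)).trans ?_
  gcongr
  exact le_max_left _ _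

end BallGeometry

/-! ### The radial profile -/

section Profile

/-- The combinations `b (ρ₀/s)^a + c (ρ₀/s)^τ`. -/
noncomputable def twoPow (a τ b c ρ₀ s : ℝ) : ℝ := b * (ρ₀ / s) ^ a + c * (ρ₀ / s) ^ τ

variable {a τ b c l ρ₀ s : ℝ}

/-- The family is closed under `-s d/ds`, which multiplies each coefficient by its exponent. All
derivatives of `D` therefore stay in it, and inequalities between them reduce to comparing
coefficients. -/
theorem hasDerivAt_twoPow (hρ : 0 < ρ₀) (hs : 0 < s) :
    HasDerivAt (twoPow a τ b c ρ₀) (-twoPow a τ (a * b) (τ * c) ρ₀ s / s) s := by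
  have h0 : HasDerivAt (fun s => ρ₀ / s) (-ρ₀ / s ^ 2) s := by
    exact ((hasDerivAt_const s ρ₀).div (hasDerivAt_id s) hs.ne').congr_deriv (by simp)
  have hne : ρ₀ / s ≠ 0 := (div_pos hρ hs).ne'
  have key : ∀ e : ℝ, HasDerivAt (fun s => (ρ₀ / s) ^ e) (-(e * (ρ₀ / s) ^ e) / s) s := by
    intro e
    refine (h0.rpow_const (p := e) (Or.inl hne)).congr_deriv ?_
    rw [Real.rpow_sub_one hne]
    field_simp
  refine (((key a).const_mul b).add ((key τ).const_mul c)).congr_deriv ?_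
  unfold twoPow
  field_simp
  ring

theorem contDiffOn_twoPow (hρ : 0 < ρ₀) {k : WithTop ℕ∞} :
    ContDiffOn ℝ k (twoPow a τ b c ρ₀) (Ioi 0) := by
  have h0 : ContDiffOn ℝ k (fun s => ρ₀ / s) (Ioi 0) :=
    contDiffOn_const.div contDiffOn_id fun s hs => (ne_of_gt hs)
  have h1 : ∀ s ∈ Ioi (0 : ℝ), ρ₀ / s ≠ 0 := fun s hs => (div_pos hρ hs).ne'
  exact (contDiffOn_const.mul (h0.rpow_const_of_ne h1)).add
    (contDiffOn_const.mul (h0.rpow_const_of_ne h1))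

/-- The denominator `1 / ξ₊`. -/
noncomputable def xiDen (a τ l ρ₀ s : ℝ) : ℝ := twoPow a τ (1 - l) l ρ₀ s

/-- The function `-s D'` for the denominator `D = 1 / ξ₊`. -/
noncomputable def xiDen₁ (a τ l ρ₀ s : ℝ) : ℝ := twoPow a τ (a * (1 - l)) (τ * l) ρ₀ s

/-- The function `(s ∂ₛ)² D` for the denominator `D = 1 / ξ₊`. -/
noncomputable def xiDen₂ (a τ l ρ₀ s : ℝ) : ℝ :=
  twoPow a τ (a * (a * (1 - l))) (τ * (τ * l)) ρ₀ s

theorem hasDerivAt_xiDen (hρ : 0 < ρ₀) (hs : 0 < s) :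
    HasDerivAt (xiDen a τ l ρ₀) (-xiDen₁ a τ l ρ₀ s / s) s := hasDerivAt_twoPow hρ hs

theorem hasDerivAt_xiDen₁ (hρ : 0 < ρ₀) (hs : 0 < s) :
    HasDerivAt (xiDen₁ a τ l ρ₀) (-xiDen₂ a τ l ρ₀ s / s) s := hasDerivAt_twoPow hρ hs

theorem xiDen_self (hρ : 0 < ρ₀) : xiDen a τ l ρ₀ ρ₀ = 1 := by
  simp [xiDen, twoPow, hρ.ne']

theorem le_xiDen (hl : l ∈ Ioo (0 : ℝ) 1) (ha : 1 ≤ a) (haτ : a < τ) (hs : 0 < s)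
    (hsρ : s ≤ ρ₀) : ρ₀ / s ≤ xiDen a τ l ρ₀ s := by
  have h1 : 1 ≤ ρ₀ / s := (one_le_div hs).2 hsρ
  have h2 := Real.self_le_rpow_of_one_le h1 ha
  have h3 := Real.self_le_rpow_of_one_le h1 (ha.trans haτ.le)
  unfold xiDen twoPow
  nlinarith [hl.1, hl.2]

theorem one_lt_xiDen (hl : l ∈ Ioo (0 : ℝ) 1) (ha : 1 ≤ a) (haτ : a < τ) (hs : s ∈ Ioo 0 ρ₀) :
    1 < xiDen a τ l ρ₀ s :=
  ((one_lt_div hs.1).2 hs.2).trans_le (le_xiDen hl ha haτ hs.1 hs.2.le)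

theorem xiDen_le (hl : l ∈ Ioo (0 : ℝ) 1) (haτ : a < τ) (hs : 0 < s)
    (hsρ : s ≤ ρ₀) : xiDen a τ l ρ₀ s ≤ (ρ₀ / s) ^ τ := by
  have h1 : 1 ≤ ρ₀ / s := (one_le_div hs).2 hsρ
  have h2 := Real.rpow_le_rpow_of_exponent_le h1 haτ.le
  unfold xiDen twoPow
  nlinarith [hl.1, hl.2]

theorem xiDen₁_nonneg (hl : l ∈ Ioo (0 : ℝ) 1) (ha : 0 ≤ a) (haτ : a < τ) (hρ : 0 < ρ₀)
    (hs : 0 < s) : 0 ≤ xiDen₁ a τ l ρ₀ s := by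
  have h1 : 0 < ρ₀ / s := div_pos hρ hs
  have := hl.1
  have := sub_pos.2 hl.2
  have : 0 < τ := ha.trans_lt haτ
  unfold xiDen₁ twoPow; positivity

theorem xiDen₁_le (hl : l ∈ Ioo (0 : ℝ) 1) (haτ : a < τ) (hρ : 0 < ρ₀)
    (hs : 0 < s) : xiDen₁ a τ l ρ₀ s ≤ τ * xiDen a τ l ρ₀ s := by
  have h1 : 0 < ρ₀ / s := div_pos hρ hs
  have h2 := mul_pos (sub_pos.2 hl.2) (Real.rpow_pos_of_pos h1 a)
  unfold xiDen₁ xiDen twoPow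
  nlinarith

theorem xiDen₂_nonneg (hl : l ∈ Ioo (0 : ℝ) 1) (ha : 0 ≤ a) (haτ : a < τ) (hρ : 0 < ρ₀)
    (hs : 0 < s) : 0 ≤ xiDen₂ a τ l ρ₀ s := by
  have h1 : 0 < ρ₀ / s := div_pos hρ hs
  have := hl.1
  have := sub_pos.2 hl.2
  have : 0 < τ := ha.trans_lt haτ
  unfold xiDen₂ twoPow; positivity

theorem xiDen₂_le (hl : l ∈ Ioo (0 : ℝ) 1) (ha : 0 ≤ a) (haτ : a < τ) (hρ : 0 < ρ₀)
    (hs : 0 < s) : xiDen₂ a τ l ρ₀ s ≤ τ ^ 2 * xiDen a τ l ρ₀ s := by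
  have h1 : 0 < ρ₀ / s := div_pos hρ hs
  have h2 := mul_pos (sub_pos.2 hl.2) (Real.rpow_pos_of_pos h1 a)
  have h3 : a * a ≤ τ ^ 2 := by nlinarith
  unfold xiDen₂ xiDen twoPow
  nlinarith

/-- The slope `ξ₊ / √(1 - ξ₊²) = (D² - 1)^{-1/2}` of the barrier. -/
noncomputable def profileSlope (a τ l ρ₀ s : ℝ) : ℝ :=
  (xiDen a τ l ρ₀ s ^ 2 - 1) ^ (-(1 / 2) : ℝ)

/-- The derivative of the slope. -/
noncomputable def profileSlope₁ (a τ l ρ₀ s : ℝ) : ℝ :=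
  xiDen a τ l ρ₀ s * xiDen₁ a τ l ρ₀ s * (xiDen a τ l ρ₀ s ^ 2 - 1) ^ (-(3 / 2) : ℝ) / s

/-- The second derivative of the slope. -/
noncomputable def profileSlope₂ (a τ l ρ₀ s : ℝ) : ℝ :=
  (3 * (xiDen a τ l ρ₀ s * xiDen₁ a τ l ρ₀ s) ^ 2
      * (xiDen a τ l ρ₀ s ^ 2 - 1) ^ (-(5 / 2) : ℝ)
    - (xiDen₁ a τ l ρ₀ s ^ 2 + xiDen a τ l ρ₀ s * xiDen₂ a τ l ρ₀ s
      + xiDen a τ l ρ₀ s * xiDen₁ a τ l ρ₀ s) * (xiDen a τ l ρ₀ s ^ 2 - 1) ^ (-(3 / 2) : ℝ))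
    / s ^ 2

theorem xiDen_sq_sub_one_pos (hl : l ∈ Ioo (0 : ℝ) 1) (ha : 1 ≤ a) (haτ : a < τ)
    (hs : s ∈ Ioo 0 ρ₀) : 0 < xiDen a τ l ρ₀ s ^ 2 - 1 := by
  nlinarith [one_lt_xiDen hl ha haτ hs]

theorem profileSlope_eq {n : ℕ} (hl : l ∈ Ioo (0 : ℝ) 1) (ha : 1 ≤ (n : ℝ) / 2)
    (haτ : (n : ℝ) / 2 < τ) (hs : s ∈ Ioo 0 ρ₀) :
    xiPlus n τ l ρ₀ s / √(1 - xiPlus n τ l ρ₀ s ^ 2) = profileSlope ((n : ℝ) / 2) τ l ρ₀ s := by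
  have h1 := one_lt_xiDen hl ha haτ hs
  have h2 := xiDen_sq_sub_one_pos hl ha haτ hs
  have e : xiPlus n τ l ρ₀ s = 1 / xiDen ((n : ℝ) / 2) τ l ρ₀ s := rfl
  rw [e]
  unfold profileSlope
  set D := xiDen ((n : ℝ) / 2) τ l ρ₀ s
  have h0 : 0 < D := one_pos.trans h1
  have e2 : 1 - (1 / D) ^ 2 = (D ^ 2 - 1) / D ^ 2 := by field_simp
  rw [e2, Real.sqrt_div h2.le, Real.sqrt_sq h0.le, Real.rpow_neg h2.le, ← Real.sqrt_eq_rpow]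
  have : 0 < √(D ^ 2 - 1) := Real.sqrt_pos.2 h2
  field_simp

theorem hasDerivAt_xiDen_sq_sub_one (hρ : 0 < ρ₀) (hs : 0 < s) :
    HasDerivAt (fun s => xiDen a τ l ρ₀ s ^ 2 - 1)
      (-2 * (xiDen a τ l ρ₀ s * xiDen₁ a τ l ρ₀ s) / s) s := by
  refine (((hasDerivAt_xiDen hρ hs).pow 2).sub_const 1).congr_deriv ?_
  simp; ring

theorem hasDerivAt_profileSlope (hl : l ∈ Ioo (0 : ℝ) 1) (ha : 1 ≤ a) (haτ : a < τ)
    (hs : s ∈ Ioo 0 ρ₀) :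
    HasDerivAt (profileSlope a τ l ρ₀) (profileSlope₁ a τ l ρ₀ s) s := by
  have h2 := xiDen_sq_sub_one_pos hl ha haτ hs
  refine ((hasDerivAt_xiDen_sq_sub_one (hs.1.trans hs.2) hs.1).rpow_const
    (p := -(1 / 2)) (Or.inl h2.ne')).congr_deriv ?_
  have e : (-(1 / 2) - 1 : ℝ) = -(3 / 2) := by norm_num
  rw [e]; unfold profileSlope₁; ring

theorem hasDerivAt_profileSlope₁ (hl : l ∈ Ioo (0 : ℝ) 1) (ha : 1 ≤ a) (haτ : a < τ)
    (hs : s ∈ Ioo 0 ρ₀) :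
    HasDerivAt (profileSlope₁ a τ l ρ₀) (profileSlope₂ a τ l ρ₀ s) s := by
  have h2 := xiDen_sq_sub_one_pos hl ha haτ hs
  have hρ := hs.1.trans hs.2
  have h0 := hs.1.ne'
  refine ((((hasDerivAt_xiDen hρ hs.1).mul (hasDerivAt_xiDen₁ hρ hs.1)).mul
    ((hasDerivAt_xiDen_sq_sub_one hρ hs.1).rpow_const
    (p := -(3 / 2)) (Or.inl h2.ne'))).div (hasDerivAt_id s) h0).congr_deriv ?_
  have e : (-(3 / 2) - 1 : ℝ) = -(5 / 2) := by norm_num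
  rw [e]; unfold profileSlope₂
  simp only [Pi.mul_apply, id_eq]
  field_simp
  ring

theorem profileSlope_pos (hl : l ∈ Ioo (0 : ℝ) 1) (ha : 1 ≤ a) (haτ : a < τ)
    (hs : s ∈ Ioo 0 ρ₀) : 0 < profileSlope a τ l ρ₀ s :=
  Real.rpow_pos_of_pos (xiDen_sq_sub_one_pos hl ha haτ hs) _

theorem profileSlope_sq (hl : l ∈ Ioo (0 : ℝ) 1) (ha : 1 ≤ a) (haτ : a < τ)
    (hs : s ∈ Ioo 0 ρ₀) : profileSlope a τ l ρ₀ s ^ 2 = (xiDen a τ l ρ₀ s ^ 2 - 1)⁻¹ := by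
  have h2 := xiDen_sq_sub_one_pos hl ha haτ hs
  unfold profileSlope
  rw [← Real.rpow_natCast, ← Real.rpow_mul h2.le, ← Real.rpow_neg_one]
  norm_num

theorem one_add_profileSlope_sq (hl : l ∈ Ioo (0 : ℝ) 1) (ha : 1 ≤ a) (haτ : a < τ)
    (hs : s ∈ Ioo 0 ρ₀) : 1 + profileSlope a τ l ρ₀ s ^ 2
      = xiDen a τ l ρ₀ s ^ 2 * profileSlope a τ l ρ₀ s ^ 2 := by
  have h2 := xiDen_sq_sub_one_pos hl ha haτ hs
  rw [profileSlope_sq hl ha haτ hs]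
  field_simp
  ring

/-- The factor `1 + p²` is isolated because the Jang operator divides the second-derivative term by
it, leaving the logarithmic derivative `sξ'/ξ = -sD'/D`. -/
theorem mul_profileSlope₁ (hl : l ∈ Ioo (0 : ℝ) 1) (ha : 1 ≤ a) (haτ : a < τ)
    (hs : s ∈ Ioo 0 ρ₀) : s * profileSlope₁ a τ l ρ₀ s =
      profileSlope a τ l ρ₀ s * (1 + profileSlope a τ l ρ₀ s ^ 2)
        * (xiDen₁ a τ l ρ₀ s / xiDen a τ l ρ₀ s) := by
  have h1 := one_lt_xiDen hl ha haτ hs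
  have h2 := xiDen_sq_sub_one_pos hl ha haτ hs
  have h0 := hs.1.ne'
  rw [one_add_profileSlope_sq hl ha haτ hs]
  have e : (xiDen a τ l ρ₀ s ^ 2 - 1) ^ (-(3 / 2) : ℝ) = profileSlope a τ l ρ₀ s ^ 3 := by
    unfold profileSlope
    rw [← Real.rpow_natCast _ 3, ← Real.rpow_mul h2.le]
    norm_num
  unfold profileSlope₁
  rw [e]
  have : xiDen a τ l ρ₀ s ≠ 0 := by linarith
  field_simp

/-- The main estimate for the ansatz: `s ξ₊' / ξ₊ - 2a + ξ₊²` is uniformly negative. -/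
theorem xiDen_ratio_bound (hl : l ∈ Ioo (0 : ℝ) 1) (ha : 1 ≤ a) (haτ : a < τ)
    (hs : s ∈ Ioo 0 ρ₀) : xiDen₁ a τ l ρ₀ s / xiDen a τ l ρ₀ s - 2 * a + (xiDen a τ l ρ₀ s)⁻¹ ^ 2
      ≤ -min (2 * a - τ) (a - (1 - l)⁻¹) := by
  have h1 := one_lt_xiDen hl ha haτ hs
  have hl1 : 0 < 1 - l := sub_pos.2 hl.2
  have hq : 1 ≤ ρ₀ / s := (one_le_div hs.1).2 hs.2.le
  have hA : 1 ≤ (ρ₀ / s) ^ a := Real.one_le_rpow hq (by linarith)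
  have hB : 0 < (ρ₀ / s) ^ τ := by positivity
  have eD : xiDen a τ l ρ₀ s = (1 - l) * (ρ₀ / s) ^ a + l * (ρ₀ / s) ^ τ := rfl
  have eD1 : xiDen₁ a τ l ρ₀ s = a * (1 - l) * (ρ₀ / s) ^ a + τ * l * (ρ₀ / s) ^ τ := rfl
  set D := xiDen a τ l ρ₀ s
  have hD : 0 < D := one_pos.trans h1
  set m := min (2 * a - τ) (a - (1 - l)⁻¹)
  have hm1 : m ≤ 2 * a - τ := min_le_left _ _
  have hm2 : m ≤ a - (1 - l)⁻¹ := min_le_right _ _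
  have hi : D⁻¹ ≤ 1 := inv_le_one_of_one_le₀ h1.le
  have hi2 : D⁻¹ ^ 2 ≤ D⁻¹ := by
    have := inv_pos.2 hD
    nlinarith
  rw [eD1]
  -- The share of the `τ`-power in `D`; the logarithmic derivative becomes the convex combination
  -- `a(1-w) + τw`.
  set w := l * (ρ₀ / s) ^ τ / D
  have hw : 0 ≤ w := by have := hl.1; positivity
  have ew : (1 - l) * (ρ₀ / s) ^ a / D = 1 - w := by
    rw [eq_sub_iff_add_eq, ← add_div, ← eD, div_self hD.ne']
  have e1 : (a * (1 - l) * (ρ₀ / s) ^ a + τ * l * (ρ₀ / s) ^ τ) / D = a * (1 - w) + τ * w := by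
    rw [← ew]; simp only [w]; ring
  have h3 : D⁻¹ ≤ (1 - w) * (1 - l)⁻¹ := by
    -- Here `(ρ₀/s)^a ≥ 1` enters: `1/D` is at most a multiple of the `a`-share `1 - w`, so its
    -- contribution is paid for by the reserve `a(1-w)` alone.
    rw [← ew, ← div_eq_mul_inv, le_div_iff₀ hl1, div_eq_mul_inv]
    have := inv_pos.2 hD
    rw [mul_comm D⁻¹]
    gcongr
    nlinarith
  have hw1 : 0 ≤ 1 - w := by rw [← ew]; positivity
  rw [e1]
  nlinarith [mul_le_mul_of_nonneg_left hm1 hw, mul_le_mul_of_nonneg_left hm2 hw1]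

theorem inv_xiDen_sq (hl : l ∈ Ioo (0 : ℝ) 1) (ha : 1 ≤ a) (haτ : a < τ)
    (hs : s ∈ Ioo 0 ρ₀) : (xiDen a τ l ρ₀ s)⁻¹ ^ 2
      = profileSlope a τ l ρ₀ s ^ 2 / (1 + profileSlope a τ l ρ₀ s ^ 2) := by
  have h := profileSlope_pos hl ha haτ hs
  have h1 := one_lt_xiDen hl ha haτ hs
  have : xiDen a τ l ρ₀ s ≠ 0 := by linarith
  rw [one_add_profileSlope_sq hl ha haτ hs]
  field_simp

/-- The quotient is `ξ = 1/D`, and `D ≤ (ρ₀/s)^τ`. The factor `ρ₀^τ` is what makes the contribution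
of `K` small relative to `ξ`. -/
theorem rpow_le_profileSlope_div (hl : l ∈ Ioo (0 : ℝ) 1) (ha : 1 ≤ a) (haτ : a < τ)
    (hs : s ∈ Ioo 0 ρ₀) : s ^ τ ≤
      ρ₀ ^ τ * (profileSlope a τ l ρ₀ s / √(1 + profileSlope a τ l ρ₀ s ^ 2)) := by
  have h := profileSlope_pos hl ha haτ hs
  have h1 := one_lt_xiDen hl ha haτ hs
  have hD : 0 < xiDen a τ l ρ₀ s := one_pos.trans h1
  have hρ := hs.1.trans hs.2
  rw [one_add_profileSlope_sq hl ha haτ hs, ← mul_pow, Real.sqrt_sq (by positivity)]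
  have e : profileSlope a τ l ρ₀ s / (xiDen a τ l ρ₀ s * profileSlope a τ l ρ₀ s)
    = (xiDen a τ l ρ₀ s)⁻¹ := by field_simp
  rw [e, ← div_eq_mul_inv, le_div_iff₀ hD]
  have := xiDen_le hl haτ hs.1 hs.2.le
  rw [Real.div_rpow hρ.le hs.1.le, le_div_iff₀ (Real.rpow_pos_of_pos hs.1 _)] at this
  linarith

theorem tendsto_profileSlope (hl : l ∈ Ioo (0 : ℝ) 1) (ha : 1 ≤ a) (haτ : a < τ) (hρ : 0 < ρ₀) :
    Tendsto (profileSlope a τ l ρ₀) (𝓝[<] ρ₀) atTop := by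
  have h1 : Tendsto (fun s => xiDen a τ l ρ₀ s ^ 2 - 1) (𝓝[<] ρ₀) (𝓝[>] 0) := by
    refine tendsto_nhdsWithin_iff.2 ⟨?_, ?_⟩
    · have := (hasDerivAt_xiDen_sq_sub_one (a := a) (τ := τ) (l := l) hρ hρ).continuousAt.tendsto
      rw [xiDen_self hρ] at this
      norm_num at this
      exact this.mono_left nhdsWithin_le_nhds
    · filter_upwards [Ioo_mem_nhdsLT hρ] with s hs
      exact xiDen_sq_sub_one_pos hl ha haτ hs
  exact (tendsto_rpow_neg_nhdsGT_zero (by norm_num)).comp h1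

/-- From `D ≥ ρ₀/s ≥ 1 + (ρ₀-s)/ρ₀` one gets `D² - 1 ≥ (ρ₀-s)/ρ₀`. The resulting majorant is
integrable up to `ρ₀`. -/
theorem profileSlope_le (hl : l ∈ Ioo (0 : ℝ) 1) (ha : 1 ≤ a) (haτ : a < τ)
    (hs : s ∈ Ioo 0 ρ₀) :
    profileSlope a τ l ρ₀ s ≤ ρ₀ ^ (1 / 2 : ℝ) * (ρ₀ - s) ^ (-(1 / 2) : ℝ) := by
  have hρ := hs.1.trans hs.2
  have hd : 0 < ρ₀ - s := sub_pos.2 hs.2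
  have e : ρ₀ ^ (1 / 2 : ℝ) * (ρ₀ - s) ^ (-(1 / 2) : ℝ) = ((ρ₀ - s) / ρ₀) ^ (-(1 / 2) : ℝ) := by
    rw [Real.div_rpow hd.le hρ.le, Real.rpow_neg hρ.le, div_inv_eq_mul, mul_comm]
  rw [e]
  refine Real.rpow_le_rpow_of_nonpos (by positivity) ?_ (by norm_num)
  have h1 := le_xiDen hl ha haτ hs.1 hs.2.le
  have h2 : 1 + (ρ₀ - s) / ρ₀ ≤ ρ₀ / s := by
    have hs1 := hs.1
    rw [le_div_iff₀ hs1, ← sub_nonneg]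
    have : ρ₀ - (1 + (ρ₀ - s) / ρ₀) * s = (ρ₀ - s) ^ 2 / ρ₀ := by field_simp; ring
    rw [this]; positivity
  have h3 : 0 ≤ (ρ₀ - s) / ρ₀ := by positivity
  nlinarith

theorem intervalIntegrable_profileSlope (hl : l ∈ Ioo (0 : ℝ) 1) (ha : 1 ≤ a) (haτ : a < τ)
    (hρ : 0 < ρ₀) : IntervalIntegrable (profileSlope a τ l ρ₀) MeasureTheory.volume 0 ρ₀ := by
  have h1 : IntervalIntegrable (fun s => ρ₀ ^ (1 / 2 : ℝ) * (ρ₀ - s) ^ (-(1 / 2) : ℝ))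
      MeasureTheory.volume 0 ρ₀ := by
    have := (intervalIntegral.intervalIntegrable_rpow' (a := ρ₀) (b := 0)
      (r := -(1 / 2)) (by norm_num)).comp_sub_left ρ₀
    simpa using this.const_mul (ρ₀ ^ (1 / 2 : ℝ))
  rw [intervalIntegrable_iff_integrableOn_Ioo_of_le hρ.le] at h1 ⊢
  refine h1.mono' ?_ ?_
  · exact ContinuousOn.aestronglyMeasurable (fun s hs =>
      (hasDerivAt_profileSlope hl ha haτ hs).continuousAt.continuousWithinAt) measurableSet_Ioo
  · filter_upwards [MeasureTheory.ae_restrict_mem measurableSet_Ioo] with s hs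
    rw [Real.norm_of_nonneg (profileSlope_pos hl ha haτ hs).le]
    exact profileSlope_le hl ha haτ hs

/-- The primitive of the slope vanishing at `0`. -/
noncomputable def profile (a τ l ρ₀ t : ℝ) : ℝ := ∫ s in (0 : ℝ)..t, profileSlope a τ l ρ₀ s

theorem profile_eq {n : ℕ} (hl : l ∈ Ioo (0 : ℝ) 1) (ha : 1 ≤ (n : ℝ) / 2)
    (haτ : (n : ℝ) / 2 < τ) (hs : 0 < s) (hsρ : s ≤ ρ₀) :
    profile ((n : ℝ) / 2) τ l ρ₀ s =
      ∫ t in (0 : ℝ)..s, xiPlus n τ l ρ₀ t / √(1 - xiPlus n τ l ρ₀ t ^ 2) := by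
  unfold profile
  -- The upper endpoint is discarded because `s = ρ₀` is allowed, while `profileSlope_eq` covers
  -- only the open interval.
  rw [intervalIntegral.integral_of_le hs.le, intervalIntegral.integral_of_le hs.le,
    MeasureTheory.integral_Ioc_eq_integral_Ioo, MeasureTheory.integral_Ioc_eq_integral_Ioo]
  refine MeasureTheory.setIntegral_congr_fun measurableSet_Ioo fun t ht => ?_
  exact (profileSlope_eq hl ha haτ ⟨ht.1, ht.2.trans_le hsρ⟩).symm

theorem hasDerivAt_profile (hl : l ∈ Ioo (0 : ℝ) 1) (ha : 1 ≤ a) (haτ : a < τ)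
    (hs : s ∈ Ioo 0 ρ₀) :
    HasDerivAt (profile a τ l ρ₀) (profileSlope a τ l ρ₀ s) s := by
  have hρ := hs.1.trans hs.2
  refine intervalIntegral.integral_hasDerivAt_right
    ((intervalIntegrable_profileSlope hl ha haτ hρ).mono_set ?_) ?_
    (hasDerivAt_profileSlope hl ha haτ hs).continuousAt
  · rw [uIcc_of_le hs.1.le, uIcc_of_le hρ.le]
    exact Icc_subset_Icc_right hs.2.le
  · exact ContinuousOn.stronglyMeasurableAtFilter isOpen_Ioo (fun t ht =>
      (hasDerivAt_profileSlope hl ha haτ ht).continuousAt.continuousWithinAt) s hs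

theorem continuousOn_profile (hl : l ∈ Ioo (0 : ℝ) 1) (ha : 1 ≤ a) (haτ : a < τ)
    (hρ : 0 < ρ₀) : ContinuousOn (profile a τ l ρ₀) (Icc 0 ρ₀) := by
  have := intervalIntegral.continuousOn_primitive_interval (μ := MeasureTheory.volume)
    (f := profileSlope a τ l ρ₀) (a := 0) (b := ρ₀) ?_
  · rwa [uIcc_of_le hρ.le] at this
  · rw [uIcc_of_le hρ.le]
    exact (intervalIntegrable_iff_integrableOn_Icc_of_le hρ.le).1
      (intervalIntegrable_profileSlope hl ha haτ hρ)

theorem profile_pos (hl : l ∈ Ioo (0 : ℝ) 1) (ha : 1 ≤ a) (haτ : a < τ)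
    (hs : s ∈ Ioo 0 ρ₀) : 0 < profile a τ l ρ₀ s := by
  have hρ := hs.1.trans hs.2
  refine intervalIntegral.intervalIntegral_pos_of_pos_on
    ((intervalIntegrable_profileSlope hl ha haτ hρ).mono_set ?_)
    (fun t ht => profileSlope_pos hl ha haτ ⟨ht.1, ht.2.trans hs.2⟩) hs.1
  rw [uIcc_of_le hs.1.le, uIcc_of_le hρ.le]
  exact Icc_subset_Icc_right hs.2.le

theorem contDiffOn_profile (hl : l ∈ Ioo (0 : ℝ) 1) (ha : 1 ≤ a) (haτ : a < τ) :
    ContDiffOn ℝ 2 (profile a τ l ρ₀) (Ioo 0 ρ₀) := by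
  have h1 : ContDiffOn ℝ 1 (profileSlope a τ l ρ₀) (Ioo 0 ρ₀) := by
    intro s hs
    have hρ := hs.1.trans hs.2
    have hD : ContDiffAt ℝ 1 (xiDen a τ l ρ₀) s :=
      (contDiffOn_twoPow hρ).contDiffAt (Ioi_mem_nhds hs.1)
    exact (((hD.pow 2).sub contDiffAt_const).rpow_const_of_ne
      (xiDen_sq_sub_one_pos hl ha haτ hs).ne').contDiffWithinAt
  rw [show (2 : WithTop ℕ∞) = 1 + 1 by norm_num, contDiffOn_succ_iff_deriv_of_isOpen isOpen_Ioo]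
  refine ⟨fun s hs => (hasDerivAt_profile hl ha haτ hs).differentiableAt.differentiableWithinAt,
    by simp, h1.congr fun s hs => (hasDerivAt_profile hl ha haτ hs).deriv⟩

end Profile

/-! ### Weighted Hölder regularity of radial functions -/

section Radial

variable {n : ℕ}

/-- The isometry does not depend on the point, so it transfers norms of differences, as the Hölder
seminorm requires, and not only norms of values. -/
theorem exists_iteratedFDeriv_two_eq {E F : Type*} [NormedAddCommGroup E] [NormedSpace ℝ E]
    [NormedAddCommGroup F] [NormedSpace ℝ F] (f : E → F) :
    ∃ L : (E →L[ℝ] E →L[ℝ] F) ≃ₗᵢ[ℝ] (E [×2]→L[ℝ] F),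
      ∀ y, iteratedFDeriv ℝ 2 f y = L (fderiv ℝ (fderiv ℝ f) y) := by
  refine ⟨((continuousMultilinearCurryFin0 ℝ E (E →L[ℝ] E →L[ℝ] F)).symm.trans
    (continuousMultilinearCurryRightEquiv' ℝ 0 E (E →L[ℝ] F)).symm).trans
    (continuousMultilinearCurryRightEquiv' ℝ 1 E F).symm, fun y => ?_⟩
  rw [iteratedFDeriv_succ_eq_comp_right, Function.comp_apply,
    iteratedFDeriv_succ_eq_comp_right (n := 0), iteratedFDeriv_zero_eq_comp]
  rfl

theorem norm_iteratedFDeriv_two_sub {E F : Type*} [NormedAddCommGroup E] [NormedSpace ℝ E]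
    [NormedAddCommGroup F] [NormedSpace ℝ F] (f : E → F) (y z : E) :
    ‖iteratedFDeriv ℝ 2 f y - iteratedFDeriv ℝ 2 f z‖
      = ‖fderiv ℝ (fderiv ℝ f) y - fderiv ℝ (fderiv ℝ f) z‖ := by
  obtain ⟨L, hL⟩ := exists_iteratedFDeriv_two_eq f
  rw [hL, hL, ← dist_eq_norm, L.dist_map, dist_eq_norm]

theorem norm_iteratedFDeriv_two {E F : Type*} [NormedAddCommGroup E] [NormedSpace ℝ E]
    [NormedAddCommGroup F] [NormedSpace ℝ F] (f : E → F) (y : E) :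
    ‖iteratedFDeriv ℝ 2 f y‖ = ‖fderiv ℝ (fderiv ℝ f) y‖ := by
  obtain ⟨L, hL⟩ := exists_iteratedFDeriv_two_eq f
  rw [hL, LinearIsometryEquiv.norm_map]

/-- The Euclidean inner product as a bilinear form. -/
noncomputable def euclInner (n : ℕ) : Euc n →L[ℝ] Euc n →L[ℝ] ℝ := innerSL ℝ

@[simp] theorem euclInner_apply (v w : Euc n) : euclInner n v w = inner ℝ v w := rfl

theorem norm_euclInner_apply (v : Euc n) : ‖euclInner n v‖ = ‖v‖ := innerSL_apply_norm ℝ v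

/-- The Hessian `φ'' dρ ⊗ dρ - φ' δ` of a radial function. -/
noncomputable def radialHess (p₁ p₂ : ℝ) (x : Euc n) : Euc n →L[ℝ] Euc n →L[ℝ] ℝ :=
  p₂ • (euclInner n x).smulRight (euclInner n x) - p₁ • euclInner n

variable {φ φ₁ φ₂ φ₃ : ℝ → ℝ} {F : Euc n → ℝ} {r : ℝ}

theorem ballRho_mem_Ioo {x : Euc n} (hx : x ∈ rhoLT n r) : ballRho x ∈ Ioo 0 r :=
  ⟨ballRho_pos_iff.2 hx.1, hx.2⟩

theorem hasFDerivAt_radial (h₁ : ∀ s ∈ Ioo 0 r, HasDerivAt φ (φ₁ s) s)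
    (hF : EqOn F (fun x => φ (ballRho x)) (rhoLT n r)) {x : Euc n} (hx : x ∈ rhoLT n r) :
    HasFDerivAt F (-(φ₁ (ballRho x)) • euclInner n x) x := by
  have h := (h₁ _ (ballRho_mem_Ioo hx)).comp_hasFDerivAt x (hasFDerivAt_ballRho x)
  refine (h.congr_fderiv ?_).congr_of_eventuallyEq
    (hF.eventuallyEq_of_mem ((isOpen_rhoLT r).mem_nhds hx))
  ext v; simp

theorem hasFDerivAt_fderiv_radial (h₁ : ∀ s ∈ Ioo 0 r, HasDerivAt φ (φ₁ s) s)
    (h₂ : ∀ s ∈ Ioo 0 r, HasDerivAt φ₁ (φ₂ s) s)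
    (hF : EqOn F (fun x => φ (ballRho x)) (rhoLT n r)) {x : Euc n} (hx : x ∈ rhoLT n r) :
    HasFDerivAt (fderiv ℝ F) (radialHess (φ₁ (ballRho x)) (φ₂ (ballRho x)) x) x := by
  have h := ((h₂ _ (ballRho_mem_Ioo hx)).comp_hasFDerivAt x (hasFDerivAt_ballRho x)).neg.smul
    ((euclInner n).hasFDerivAt (x := x))
  refine (h.congr_fderiv ?_).congr_of_eventuallyEq
    (Filter.eventuallyEq_of_mem ((isOpen_rhoLT r).mem_nhds hx)
      fun y hy => (hasFDerivAt_radial h₁ hF hy).fderiv)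
  ext v w
  simp [radialHess]
  ring

theorem norm_euclInner_le_one : ‖euclInner n‖ ≤ 1 :=
  ContinuousLinearMap.opNorm_le_bound _ zero_le_one fun x => by
    rw [one_mul]; exact (norm_euclInner_apply x).le

theorem norm_radialHess_le {x : Euc n} (hx : ‖x‖ < 1) (p₁ p₂ : ℝ) :
    ‖radialHess p₁ p₂ x‖ ≤ |p₂| + |p₁| := by
  unfold radialHess
  refine (norm_sub_le (p₂ • (euclInner n x).smulRight (euclInner n x))
    (p₁ • euclInner n)).trans (add_le_add ?_ ?_)
  · rw [norm_smul, ContinuousLinearMap.norm_smulRight_apply, norm_euclInner_apply, Real.norm_eq_abs]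
    have : ‖x‖ * ‖x‖ ≤ 1 := mul_le_one₀ hx.le (norm_nonneg _) hx.le
    exact mul_le_of_le_one_right (abs_nonneg _) this
  · rw [norm_smul, Real.norm_eq_abs]
    exact mul_le_of_le_one_right (abs_nonneg _) norm_euclInner_le_one

/-- Uses `y⊗y - z⊗z = (y-z)⊗y + z⊗(y-z)` with both points in the unit ball. -/
theorem norm_radialHess_sub_le {y z : Euc n} (hy : ‖y‖ < 1) (hz : ‖z‖ < 1) (p₁ p₂ q₁ q₂ : ℝ) :
    ‖radialHess p₁ p₂ y - radialHess q₁ q₂ z‖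
      ≤ |p₂ - q₂| + |p₁ - q₁| + 2 * |q₂| * dist y z := by
  have e : radialHess p₁ p₂ y - radialHess q₁ q₂ z = radialHess (p₁ - q₁) (p₂ - q₂) y
      + (q₂ • (euclInner n (y - z)).smulRight (euclInner n y)
        + q₂ • (euclInner n z).smulRight (euclInner n (y - z))) := by
    ext v w
    simp [radialHess]
    ring
  rw [e]
  refine (norm_add_le (radialHess (p₁ - q₁) (p₂ - q₂) y) _).trans
    (add_le_add (norm_radialHess_le hy _ _) ?_)
  refine (norm_add_le (q₂ • (euclInner n (y - z)).smulRight (euclInner n y)) _).trans ?_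
  rw [norm_smul, ContinuousLinearMap.norm_smulRight_apply, norm_euclInner_apply, norm_euclInner_apply,
    norm_smul, ContinuousLinearMap.norm_smulRight_apply, norm_euclInner_apply, norm_euclInner_apply,
    Real.norm_eq_abs, dist_eq_norm]
  have h1 : ‖y - z‖ * ‖y‖ ≤ ‖y - z‖ := mul_le_of_le_one_right (norm_nonneg _) hy.le
  have h2 : ‖z‖ * ‖y - z‖ ≤ ‖y - z‖ := mul_le_of_le_one_left (norm_nonneg _) hz.le
  nlinarith [mul_le_mul_of_nonneg_left h1 (abs_nonneg q₂),
    mul_le_mul_of_nonneg_left h2 (abs_nonneg q₂)]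

theorem abs_sub_le_of_hasDerivAt_le {f f' : ℝ → ℝ} {a b B : ℝ}
    (hf : ∀ s ∈ uIcc a b, HasDerivAt f (f' s) s) (hB : ∀ s ∈ uIcc a b, |f' s| ≤ B) :
    |f b - f a| ≤ B * |b - a| :=
  (convex_uIcc a b).norm_image_sub_le_of_norm_hasDerivWithin_le
    (fun s hs => (hf s hs).hasDerivWithinAt) hB left_mem_uIcc right_mem_uIcc

/-- A radial function whose derivatives decay like powers of `ρ` lies in a weighted Hölder
space. -/
theorem isWeightedHolder_radial {α τ C : ℝ} (hα : α ∈ Ioo (0 : ℝ) 1) (hτ : 0 ≤ τ) (hC : 0 ≤ C)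
    (hφ : ContDiffOn ℝ 2 φ (Ioo 0 r))
    (h₁ : ∀ s ∈ Ioo 0 r, HasDerivAt φ (φ₁ s) s)
    (h₂ : ∀ s ∈ Ioo 0 r, HasDerivAt φ₁ (φ₂ s) s)
    (h₃ : ∀ s ∈ Ioo 0 r, HasDerivAt φ₂ (φ₃ s) s)
    (b₀ : ∀ s ∈ Ioo 0 r, |φ s| ≤ C * s ^ (τ + 1))
    (b₁ : ∀ s ∈ Ioo 0 r, |φ₁ s| ≤ C * s ^ τ)
    (b₂ : ∀ s ∈ Ioo 0 r, s * |φ₂ s| ≤ C * s ^ τ)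
    (b₃ : ∀ s ∈ Ioo 0 r, s ^ 2 * |φ₃ s| ≤ C * s ^ τ)
    (hF : EqOn F (fun x => φ (ballRho x)) (rhoLT n r)) :
    IsWeightedHolder 0 2 α (τ + 1) (rhoLT n r) F := by
  obtain ⟨B, hB, hdist⟩ := exists_dist_le_mul_ballRho n
  set e := Real.exp 1
  have he : 1 ≤ e := Real.one_le_exp zero_le_one
  have he0 : 0 < e := one_pos.trans_le he
  have heτ : 0 < e ^ τ := Real.rpow_pos_of_pos he0 _
  refine ⟨(hφ.comp contDiff_ballRho.contDiffOn fun x hx => ballRho_mem_Ioo hx).congr hF,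
    -- `e^τ` pays for comparing `ρ` across a unit ball, `4e²` bounds the `e² + 3e` of the Hessian
    -- difference, and `B^(1-α)` comes from passing from a Lipschitz to a Hölder bound; the summand
    -- `1` serves the pointwise bounds.
    C * e ^ τ * (4 * e ^ 2) * (1 + B ^ (1 - α)), fun x hx hsub => ?_⟩
  set ρ := ballRho x
  have hρ : 0 < ρ := ballRho_pos_iff.2 hx
  have hρ1 : ρ ≤ 1 := (ballRho_le_half x).trans (by norm_num)
  have hBα : 0 < B ^ (1 - α) := Real.rpow_pos_of_pos hB _
  have hρτ : ρ ^ (τ + 1) = ρ ^ τ * ρ := by rw [Real.rpow_add_one hρ.ne']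
  have hcmp : ∀ s, 0 < s → s ≤ e * ρ → s ^ τ ≤ e ^ τ * ρ ^ τ := by
    intro s hs hs'
    rw [← Real.mul_rpow he0.le hρ.le]
    exact Real.rpow_le_rpow hs.le hs' hτ
  have B₁ : ∀ s ∈ Ioo 0 r, s ≤ e * ρ → |φ₁ s| ≤ C * e ^ τ * ρ ^ τ := by
    intro s hs hs'
    rw [mul_assoc]
    exact (b₁ s hs).trans (mul_le_mul_of_nonneg_left (hcmp s hs.1 hs') hC)
  have B₂ : ∀ s ∈ Ioo 0 r, s ≤ e * ρ → ρ ≤ e * s → ρ * |φ₂ s| ≤ e * (C * e ^ τ * ρ ^ τ) := by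
    intro s hs hs' hs''
    calc ρ * |φ₂ s| ≤ (e * s) * |φ₂ s| := by gcongr
      _ = e * (s * |φ₂ s|) := by ring
      _ ≤ e * (C * s ^ τ) := by exact mul_le_mul_of_nonneg_left (b₂ s hs) he0.le
      _ ≤ e * (C * (e ^ τ * ρ ^ τ)) := by gcongr; exact hcmp s hs.1 hs'
      _ = _ := by ring
  have B₃ : ∀ s ∈ Ioo 0 r, s ≤ e * ρ → ρ ≤ e * s →
      ρ ^ 2 * |φ₃ s| ≤ e ^ 2 * (C * e ^ τ * ρ ^ τ) := by
    intro s hs hs' hs''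
    calc ρ ^ 2 * |φ₃ s| ≤ (e * s) ^ 2 * |φ₃ s| := by gcongr
      _ = e ^ 2 * (s ^ 2 * |φ₃ s|) := by ring
      _ ≤ e ^ 2 * (C * s ^ τ) := by exact mul_le_mul_of_nonneg_left (b₃ s hs) (by positivity)
      _ ≤ e ^ 2 * (C * (e ^ τ * ρ ^ τ)) := by gcongr; exact hcmp s hs.1 hs'
      _ = _ := by ring
  have hee : e ≤ e ^ 2 := by nlinarith
  have hP : 0 ≤ C * e ^ τ * ρ ^ τ := by positivity
  constructor
  · intro j hj y hy
    have hyr := ballRho_mem_Ioo (hsub hy)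
    have hle := ballRho_le_of_mem_hypBall hx hy
    have hle' := ballRho_le_of_mem_hypBall' hx hy
    suffices h : ρ ^ (0 + j) * ‖iteratedFDeriv ℝ j F y‖
        ≤ C * e ^ τ * ρ ^ τ * ρ * (4 * e ^ 2) by
      refine h.trans ?_
      rw [hρτ]
      have : 0 ≤ C * e ^ τ * ρ ^ τ * ρ * (4 * e ^ 2) * B ^ (1 - α) := by positivity
      linarith
    interval_cases j
    · rw [norm_iteratedFDeriv_zero, Real.norm_eq_abs, hF (hsub hy)]
      have h1 := b₀ _ hyr
      rw [Real.rpow_add_one hyr.1.ne'] at h1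
      simp only [pow_zero, one_mul, zero_add]
      calc |φ (ballRho y)| ≤ C * (ballRho y ^ τ * ballRho y) := h1
        _ ≤ C * ((e ^ τ * ρ ^ τ) * (e * ρ)) := by
          gcongr
          · exact hyr.1.le
          · exact hcmp _ hyr.1 hle
        _ = C * e ^ τ * ρ ^ τ * ρ * e := by ring
        _ ≤ _ := by gcongr; linarith
    · rw [norm_iteratedFDeriv_one, (hasFDerivAt_radial h₁ hF (hsub hy)).fderiv, norm_smul,
        norm_euclInner_apply, norm_neg, Real.norm_eq_abs]
      have h1 := B₁ _ hyr hle
      have h2 : |φ₁ (ballRho y)| * ‖y‖ ≤ C * e ^ τ * ρ ^ τ :=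
        (mul_le_of_le_one_right (abs_nonneg _) hy.1.le).trans h1
      simp only [zero_add, pow_one]
      calc ρ * (|φ₁ (ballRho y)| * ‖y‖) ≤ ρ * (C * e ^ τ * ρ ^ τ) := by gcongr
        _ = C * e ^ τ * ρ ^ τ * ρ * 1 := by ring
        _ ≤ _ := by gcongr; nlinarith
    · rw [norm_iteratedFDeriv_two, (hasFDerivAt_fderiv_radial h₁ h₂ hF (hsub hy)).fderiv]
      have h1 := B₁ _ hyr hle
      have h2 := B₂ _ hyr hle hle'
      simp only [zero_add]
      calc ρ ^ 2 * ‖radialHess (φ₁ (ballRho y)) (φ₂ (ballRho y)) y‖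
          ≤ ρ ^ 2 * (|φ₂ (ballRho y)| + |φ₁ (ballRho y)|) := by
            gcongr; exact norm_radialHess_le hy.1 _ _
        _ = ρ * (ρ * |φ₂ (ballRho y)| + ρ * |φ₁ (ballRho y)|) := by ring
        _ ≤ ρ * (e * (C * e ^ τ * ρ ^ τ) + 1 * (C * e ^ τ * ρ ^ τ)) := by gcongr
        _ = C * e ^ τ * ρ ^ τ * ρ * (e + 1) := by ring
        _ ≤ _ := by gcongr; nlinarith
  · intro y hy z hz
    have hyr := ballRho_mem_Ioo (hsub hy)
    have hzr := ballRho_mem_Ioo (hsub hz)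
    have hley := ballRho_le_of_mem_hypBall hx hy
    have hley' := ballRho_le_of_mem_hypBall' hx hy
    have hlez := ballRho_le_of_mem_hypBall hx hz
    have hlez' := ballRho_le_of_mem_hypBall' hx hz
    -- The mean value theorem is applied in the variable `ρ`, so comparability with `ρ(x)` is needed
    -- at every intermediate value.
    have hs : ∀ s ∈ uIcc (ballRho z) (ballRho y), s ∈ Ioo 0 r ∧ s ≤ e * ρ ∧ ρ ≤ e * s := by
      intro s hs
      rw [mem_uIcc] at hs
      have hle : ∀ a, a ≤ s → ρ ≤ e * a → ρ ≤ e * s := fun a h1 h2 =>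
        h2.trans (mul_le_mul_of_nonneg_left h1 he0.le)
      rcases hs with hs | hs
      · exact ⟨⟨hzr.1.trans_le hs.1, hs.2.trans_lt hyr.2⟩, hs.2.trans hley, hle _ hs.1 hlez'⟩
      · exact ⟨⟨hyr.1.trans_le hs.1, hs.2.trans_lt hzr.2⟩, hs.2.trans hlez, hle _ hs.1 hley'⟩
    have hd := abs_ballRho_sub_le hy.1 hz.1
    set P := C * e ^ τ * ρ ^ τ
    have m₂ : ρ ^ 2 * |φ₂ (ballRho y) - φ₂ (ballRho z)| ≤ e ^ 2 * P * dist y z := by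
      have := abs_sub_le_of_hasDerivAt_le (B := e ^ 2 * P / ρ ^ 2)
        (fun s h => h₃ s (hs s h).1) fun s h => by
          rw [le_div_iff₀' (by positivity)]
          exact B₃ s (hs s h).1 (hs s h).2.1 (hs s h).2.2
      calc _ ≤ ρ ^ 2 * (e ^ 2 * P / ρ ^ 2 * |ballRho y - ballRho z|) := by gcongr
        _ = e ^ 2 * P * |ballRho y - ballRho z| := by field_simp
        _ ≤ _ := by gcongr
    have m₁ : ρ * |φ₁ (ballRho y) - φ₁ (ballRho z)| ≤ e * P * dist y z := by
      have := abs_sub_le_of_hasDerivAt_le (B := e * P / ρ)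
        (fun s h => h₂ s (hs s h).1) fun s h => by
          rw [le_div_iff₀' hρ]
          exact B₂ s (hs s h).1 (hs s h).2.1 (hs s h).2.2
      calc _ ≤ ρ * (e * P / ρ * |ballRho y - ballRho z|) := by gcongr
        _ = e * P * |ballRho y - ballRho z| := by field_simp
        _ ≤ _ := by gcongr
    have m₀ := B₂ _ hzr hlez hlez'
    rw [norm_iteratedFDeriv_two_sub, (hasFDerivAt_fderiv_radial h₁ h₂ hF (hsub hy)).fderiv,
      (hasFDerivAt_fderiv_radial h₁ h₂ hF (hsub hz)).fderiv]
    have hN := norm_radialHess_sub_le hy.1 hz.1 (φ₁ (ballRho y)) (φ₂ (ballRho y))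
      (φ₁ (ballRho z)) (φ₂ (ballRho z))
    set N := ‖radialHess (φ₁ (ballRho y)) (φ₂ (ballRho y)) y
      - radialHess (φ₁ (ballRho z)) (φ₂ (ballRho z)) z‖
    have hd0 : 0 ≤ dist y z := dist_nonneg
    have key : ρ ^ 2 * N ≤ P * (4 * e ^ 2) * dist y z := by
      calc ρ ^ 2 * N ≤ ρ ^ 2 * (|φ₂ (ballRho y) - φ₂ (ballRho z)|
            + |φ₁ (ballRho y) - φ₁ (ballRho z)| + 2 * |φ₂ (ballRho z)| * dist y z) := by gcongr
        _ = ρ ^ 2 * |φ₂ (ballRho y) - φ₂ (ballRho z)|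
            + ρ * (ρ * |φ₁ (ballRho y) - φ₁ (ballRho z)|)
            + 2 * (ρ * (ρ * |φ₂ (ballRho z)|)) * dist y z := by ring
        _ ≤ e ^ 2 * P * dist y z + 1 * (e * P * dist y z) + 2 * (1 * (e * P)) * dist y z := by
          gcongr
        _ = P * (e ^ 2 + 3 * e) * dist y z := by ring
        _ ≤ _ := by gcongr; linarith
    -- Splitting `d = d^(1-α) d^α` and using `d ≤ Bρ` yields exactly the power of `ρ` demanded by
    -- the weight of the seminorm.
    have hdα : dist y z ≤ B ^ (1 - α) * ρ ^ (1 - α) * dist y z ^ α := by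
      rw [← Real.mul_rpow hB.le hρ.le]
      calc dist y z = dist y z ^ (1 - α) * dist y z ^ α := by
            rw [← Real.rpow_add' hd0 (by norm_num)]; simp
        _ ≤ _ := by
          gcongr
          · exact sub_nonneg.2 hα.2.le
          · exact hdist x hx y hy z hz
    have hρ2 : ρ ^ (((0 : ℕ) : ℝ) + (2 : ℕ) + α) = ρ ^ α * ρ ^ 2 := by
      rw [← Real.rpow_natCast, ← Real.rpow_add hρ]; congr 1; push_cast; ring
    have hρα : ρ ^ α * ρ ^ (1 - α) = ρ := by rw [← Real.rpow_add hρ]; simp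
    have hdα0 : 0 ≤ dist y z ^ α := Real.rpow_nonneg hd0 _
    rw [hρ2, hρτ]
    calc ρ ^ α * ρ ^ 2 * N = ρ ^ α * (ρ ^ 2 * N) := by ring
      _ ≤ ρ ^ α * (P * (4 * e ^ 2) * (B ^ (1 - α) * ρ ^ (1 - α) * dist y z ^ α)) := by
        exact mul_le_mul_of_nonneg_left
          (key.trans (mul_le_mul_of_nonneg_left hdα (by positivity))) (by positivity)
      _ = P * (4 * e ^ 2) * B ^ (1 - α) * (ρ ^ α * ρ ^ (1 - α)) * dist y z ^ α := by ring
      _ = P * (4 * e ^ 2) * B ^ (1 - α) * ρ * dist y z ^ α := by rw [hρα]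
      _ ≤ P * (4 * e ^ 2) * (1 + B ^ (1 - α)) * ρ * dist y z ^ α := by gcongr; linarith
      _ = _ := by simp only [P]; ring

end Radial

/-! ### Decay of the profile and its derivatives at infinity -/

section ProfileBounds

variable {a τ l ρ₀ : ℝ}

theorem mul_profileSlope₁_eq (hl : l ∈ Ioo (0 : ℝ) 1) (ha : 1 ≤ a) (haτ : a < τ) {s : ℝ}
    (hs : s ∈ Ioo 0 ρ₀) : s * profileSlope₁ a τ l ρ₀ s =
      xiDen a τ l ρ₀ s * xiDen₁ a τ l ρ₀ s * profileSlope a τ l ρ₀ s ^ 3 := by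
  have h1 := one_lt_xiDen hl ha haτ hs
  have : xiDen a τ l ρ₀ s ≠ 0 := by linarith
  rw [mul_profileSlope₁ hl ha haτ hs, one_add_profileSlope_sq hl ha haτ hs]
  field_simp

theorem sq_mul_profileSlope₂_eq (hl : l ∈ Ioo (0 : ℝ) 1) (ha : 1 ≤ a) (haτ : a < τ) {s : ℝ}
    (hs : s ∈ Ioo 0 ρ₀) : s ^ 2 * profileSlope₂ a τ l ρ₀ s =
      3 * (xiDen a τ l ρ₀ s * xiDen₁ a τ l ρ₀ s) ^ 2 * profileSlope a τ l ρ₀ s ^ 5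
      - (xiDen₁ a τ l ρ₀ s ^ 2 + xiDen a τ l ρ₀ s * xiDen₂ a τ l ρ₀ s
      + xiDen a τ l ρ₀ s * xiDen₁ a τ l ρ₀ s) * profileSlope a τ l ρ₀ s ^ 3 := by
  have h2 := xiDen_sq_sub_one_pos hl ha haτ hs
  have h0 := hs.1.ne'
  have e3 : (xiDen a τ l ρ₀ s ^ 2 - 1) ^ (-(3 / 2) : ℝ) = profileSlope a τ l ρ₀ s ^ 3 := by
    unfold profileSlope
    rw [← Real.rpow_natCast _ 3, ← Real.rpow_mul h2.le]; norm_num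
  have e5 : (xiDen a τ l ρ₀ s ^ 2 - 1) ^ (-(5 / 2) : ℝ) = profileSlope a τ l ρ₀ s ^ 5 := by
    unfold profileSlope
    rw [← Real.rpow_natCast _ 5, ← Real.rpow_mul h2.le]; norm_num
  unfold profileSlope₂
  rw [e3, e5]
  field_simp

/-- For `s < r < ρ₀` one has `D ≥ ρ₀/r > 1`, so `D² - 1 ≥ κD²` and the slope is at most
`κ^(-1/2)/D`. Since `D₁` and `D₂` are at most multiples of `D`, the scaled derivatives of the slope
are `O(1/D)` too, and `1/D ≤ s^τ/(λρ₀^τ)`. Integrating the slope bound gains the extra power of `s`.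
-/
theorem exists_profile_bounds (hl : l ∈ Ioo (0 : ℝ) 1) (ha : 1 ≤ a) (haτ : a < τ) {r : ℝ}
    (hr : r ∈ Ioo 0 ρ₀) : ∃ C ≥ 0, ∀ s ∈ Ioo 0 r, |profile a τ l ρ₀ s| ≤ C * s ^ (τ + 1) ∧
      |profileSlope a τ l ρ₀ s| ≤ C * s ^ τ ∧ s * |profileSlope₁ a τ l ρ₀ s| ≤ C * s ^ τ ∧
      s ^ 2 * |profileSlope₂ a τ l ρ₀ s| ≤ C * s ^ τ := by
  have hρ := hr.1.trans hr.2
  have ha0 : 0 ≤ a := by linarith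
  have hτ : 0 < τ := by linarith
  set κ := 1 - (r / ρ₀) ^ 2
  have hrρ : r / ρ₀ < 1 := (div_lt_one hρ).2 hr.2
  have hrρ0 : 0 < r / ρ₀ := div_pos hr.1 hρ
  have hκ : 0 < κ := by simp only [κ]; nlinarith
  set k := κ ^ (-(1 / 2) : ℝ)
  have hk : 0 < k := Real.rpow_pos_of_pos hκ _
  set A := (l * ρ₀ ^ τ)⁻¹
  have hA : 0 < A := by have := hl.1; positivity
  -- The sum of the three constants needed for the slope and for its first and second scaled
  -- derivatives.
  set m := k + τ * k ^ 3 + (3 * τ ^ 2 * k ^ 5 + (2 * τ ^ 2 + τ) * k ^ 3)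
  have hm : 0 < m := by positivity
  have main : ∀ s ∈ Ioo 0 r, profileSlope a τ l ρ₀ s ≤ k * (xiDen a τ l ρ₀ s)⁻¹ ∧
      (xiDen a τ l ρ₀ s)⁻¹ ≤ A * s ^ τ := by
    intro s hs
    have hs' : s ∈ Ioo 0 ρ₀ := ⟨hs.1, hs.2.trans hr.2⟩
    have h1 := le_xiDen hl ha haτ hs.1 hs'.2.le
    have hD := one_lt_xiDen hl ha haτ hs'
    have hlD : l * (ρ₀ / s) ^ τ ≤ xiDen a τ l ρ₀ s := by
      have := sub_pos.2 hl.2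
      have h := Real.rpow_pos_of_pos (div_pos hρ hs.1) a
      unfold xiDen twoPow; nlinarith
    unfold profileSlope
    set D := xiDen a τ l ρ₀ s
    have hD0 : 0 < D := one_pos.trans hD
    constructor
    · have h2 : κ * D ^ 2 ≤ D ^ 2 - 1 := by
        have h3 : 1 ≤ (r / ρ₀) * D := by
          calc 1 = (r / ρ₀) * (ρ₀ / r) := by field_simp [hr.1.ne']
            _ ≤ (r / ρ₀) * (ρ₀ / s) := by
              have := hs.1
              have := hs.2.le
              gcongr
            _ ≤ _ := by gcongr
        have : 1 ≤ ((r / ρ₀) * D) ^ 2 := one_le_pow₀ h3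
        simp only [κ]; nlinarith
      calc (D ^ 2 - 1) ^ (-(1 / 2) : ℝ) ≤ (κ * D ^ 2) ^ (-(1 / 2) : ℝ) :=
            Real.rpow_le_rpow_of_nonpos (by positivity) h2 (by norm_num)
        _ = k * (D ^ 2) ^ (-(1 / 2) : ℝ) := by rw [Real.mul_rpow hκ.le (by positivity)]
        _ = k * D⁻¹ := by
          rw [← Real.rpow_natCast D 2, ← Real.rpow_mul hD0.le, ← Real.rpow_neg_one]; norm_num
    · have hsτ := Real.rpow_pos_of_pos hs.1 τ
      have hρτ := Real.rpow_pos_of_pos hρ τ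
      have hl0 := hl.1
      rw [Real.div_rpow hρ.le hs.1.le] at hlD
      have : A * s ^ τ = (l * (ρ₀ ^ τ / s ^ τ))⁻¹ := by simp only [A]; field_simp
      rw [this]
      exact inv_anti₀ (by positivity) hlD
  have slope : ∀ s ∈ Ioo 0 r, |profileSlope a τ l ρ₀ s| ≤ m * A * s ^ τ := by
    intro s hs
    obtain ⟨h1, h2⟩ := main s hs
    rw [abs_of_pos (profileSlope_pos hl ha haτ ⟨hs.1, hs.2.trans hr.2⟩), mul_assoc]
    refine h1.trans (mul_le_mul ?_ h2 (inv_nonneg.2 ?_) hm.le)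
    · have : 0 ≤ τ * k ^ 3 + (3 * τ ^ 2 * k ^ 5 + (2 * τ ^ 2 + τ) * k ^ 3) := by positivity
      simp only [m]; linarith
    · linarith [one_lt_xiDen hl ha haτ ⟨hs.1, hs.2.trans hr.2⟩]
  refine ⟨m * A, by positivity, fun s hs => ⟨?_, slope s hs, ?_, ?_⟩⟩
  · have h := intervalIntegral.norm_integral_le_of_norm_le_const (a := 0) (b := s)
      (f := profileSlope a τ l ρ₀) (C := m * A * s ^ τ) fun t ht => by
        rw [uIoc_of_le hs.1.le] at ht
        refine (slope t ⟨ht.1, ht.2.trans_lt hs.2⟩).trans ?_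
        have := ht.1
        have := ht.2
        gcongr
    rw [Real.rpow_add_one hs.1.ne', ← mul_assoc]
    rwa [sub_zero, abs_of_pos hs.1] at h
  all_goals
    have hs' : s ∈ Ioo 0 ρ₀ := ⟨hs.1, hs.2.trans hr.2⟩
    obtain ⟨h1, h2⟩ := main s hs
    have hD : 0 < xiDen a τ l ρ₀ s := one_pos.trans (one_lt_xiDen hl ha haτ hs')
    have hψ := profileSlope_pos hl ha haτ hs'
    have hD1 := xiDen₁_nonneg hl ha0 haτ hρ hs.1
    have hD1' := xiDen₁_le hl haτ hρ hs.1
    have hD2 := xiDen₂_nonneg hl ha0 haτ hρ hs.1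
    have hD2' := xiDen₂_le hl ha0 haτ hρ hs.1
  · have e : s * |profileSlope₁ a τ l ρ₀ s| = |s * profileSlope₁ a τ l ρ₀ s| := by
      rw [abs_mul, abs_of_pos hs.1]
    rw [e, mul_profileSlope₁_eq hl ha haτ hs', abs_of_nonneg (by positivity)]
    set D := xiDen a τ l ρ₀ s
    calc _ ≤ D * (τ * D) * (k * D⁻¹) ^ 3 := by gcongr
      _ = τ * k ^ 3 * D⁻¹ := by field_simp
      _ ≤ m * (A * s ^ τ) := by
        gcongr
        have : 0 ≤ k + (3 * τ ^ 2 * k ^ 5 + (2 * τ ^ 2 + τ) * k ^ 3) := by positivity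
        simp only [m]; linarith
      _ = _ := by ring
  · have e : s ^ 2 * |profileSlope₂ a τ l ρ₀ s| = |s ^ 2 * profileSlope₂ a τ l ρ₀ s| := by
      rw [abs_mul, abs_of_pos (pow_pos hs.1 2)]
    rw [e, sq_mul_profileSlope₂_eq hl ha haτ hs']
    refine (abs_sub _ _).trans ?_
    rw [abs_of_nonneg (by positivity), abs_of_nonneg (by positivity)]
    set D := xiDen a τ l ρ₀ s
    calc _ ≤ 3 * (D * (τ * D)) ^ 2 * (k * D⁻¹) ^ 5 + ((τ * D) ^ 2 + D * (τ ^ 2 * D)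
          + D * (τ * D)) * (k * D⁻¹) ^ 3 := by gcongr
      _ = (3 * τ ^ 2 * k ^ 5 + (2 * τ ^ 2 + τ) * k ^ 3) * D⁻¹ := by field_simp; ring
      _ ≤ m * (A * s ^ τ) := by
        gcongr
        have : 0 ≤ k + τ * k ^ 3 := by positivity
        simp only [m]; linarith
      _ = _ := by ring

theorem isWeightedHolder_profile {n : ℕ} {α : ℝ} (hα : α ∈ Ioo (0 : ℝ) 1)
    (hl : l ∈ Ioo (0 : ℝ) 1) (ha : 1 ≤ a) (haτ : a < τ) {r : ℝ} (hr : r ∈ Ioo 0 ρ₀)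
    {F : Euc n → ℝ} (hF : EqOn F (fun x => profile a τ l ρ₀ (ballRho x)) (rhoLT n r)) :
    IsWeightedHolder 0 2 α (τ + 1) (rhoLT n r) F := by
  obtain ⟨C, hC, h⟩ := exists_profile_bounds hl ha haτ hr
  have hsub : Ioo 0 r ⊆ Ioo 0 ρ₀ := Ioo_subset_Ioo_right hr.2.le
  exact isWeightedHolder_radial hα (by linarith) hC ((contDiffOn_profile hl ha haτ).mono hsub)
    (fun s hs => hasDerivAt_profile hl ha haτ (hsub hs))
    (fun s hs => hasDerivAt_profileSlope hl ha haτ (hsub hs))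
    (fun s hs => hasDerivAt_profileSlope₁ hl ha haτ (hsub hs))
    (fun s hs => (h s hs).1) (fun s hs => (h s hs).2.1) (fun s hs => (h s hs).2.2.1)
    (fun s hs => (h s hs).2.2.2) hF

end ProfileBounds

/-! ### Asymptotic equality at infinity -/

section Asymptotics

open Asymptotics

variable {n : ℕ}

/-- `A` and `B` are bounded near the sphere at infinity and their difference tends to zero. -/
structure AsympEq (A B : Euc n → ℝ) : Prop where
  bdd : B =O[sphereAtInfinity n] (fun _ => (1 : ℝ))
  lim : (fun x => A x - B x) =o[sphereAtInfinity n] (fun _ => (1 : ℝ))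

namespace AsympEq

variable {A B A' B' D : Euc n → ℝ}

theorem refl (h : B =O[sphereAtInfinity n] (fun _ => (1 : ℝ))) : AsympEq B B :=
  ⟨h, by simpa using tendsto_const_nhds⟩

theorem const (b : ℝ) : AsympEq (n := n) (fun _ => b) (fun _ => b) :=
  refl (isBigO_const_const _ one_ne_zero _)

theorem coord (i : Fin n) : AsympEq (n := n) (fun x => x i) (fun x => x i) := by
  refine refl (IsBigO.of_bound 1 ?_)
  filter_upwards [eventually_ballRho_pos] with x hx
  have := (PiLp.norm_apply_le x i).trans (ballRho_pos_iff.1 hx).le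
  simpa using this

theorem add (h : AsympEq A B) (h' : AsympEq A' B') :
    AsympEq (fun x => A x + A' x) (fun x => B x + B' x) :=
  ⟨h.bdd.add h'.bdd, (h.lim.add h'.lim).congr_left fun _ => by ring⟩

theorem neg (h : AsympEq A B) : AsympEq (fun x => -A x) (fun x => -B x) :=
  ⟨h.bdd.neg_left, h.lim.neg_left.congr_left fun _ => by ring⟩

theorem sub (h : AsympEq A B) (h' : AsympEq A' B') :
    AsympEq (fun x => A x - A' x) (fun x => B x - B' x) := by
  simpa only [sub_eq_add_neg] using h.add h'.neg

/-- Boundedness of the model factors is what makes the relation multiplicative. Models may depend on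
the angle, so plain convergence would not suffice for expressions in the coordinates. -/
theorem mul (h : AsympEq A B) (h' : AsympEq A' B') :
    AsympEq (fun x => A x * A' x) (fun x => B x * B' x) := by
  refine ⟨by simpa using h.bdd.mul h'.bdd, ?_⟩
  have h1 := h.lim.mul h'.lim
  have h2 := h.lim.mul_isBigO h'.bdd
  have h3 := h.bdd.mul_isLittleO h'.lim
  simp only [mul_one] at h1 h2 h3
  exact ((h1.add h2).add h3).congr_left fun _ => by ring

theorem sum {ι : Type*} {s : Finset ι} {A B : ι → Euc n → ℝ} (h : ∀ i ∈ s, AsympEq (A i) (B i)) :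
    AsympEq (fun x => ∑ i ∈ s, A i x) (fun x => ∑ i ∈ s, B i x) :=
  ⟨IsBigO.fun_sum fun i hi => (h i hi).bdd,
    (IsLittleO.fun_sum fun i hi => (h i hi).lim).congr_left fun _ => by
      rw [Finset.sum_sub_distrib]⟩

theorem trans (h : AsympEq A B) (h' : AsympEq B D) : AsympEq A D :=
  ⟨h'.bdd, (h.lim.add h'.lim).congr_left fun _ => by ring⟩

theorem congr_left (h : AsympEq A B) (h' : ∀ᶠ x in sphereAtInfinity n, A' x = A x) :
    AsympEq A' B :=
  ⟨h.bdd, h.lim.congr' (h'.mono fun x hx => by simp [hx]) EventuallyEq.rfl⟩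

theorem congr_right (h : AsympEq A B) (h' : ∀ x, B x = B' x) : AsympEq A B' := by
  rwa [funext h'] at h

theorem tendsto {b : ℝ} (h : AsympEq A fun _ => b) : Tendsto A (sphereAtInfinity n) (𝓝 b) := by
  have := (isLittleO_one_iff ℝ).1 h.lim
  simpa using this.add_const b

theorem of_tendsto {b : ℝ} (h : Tendsto A (sphereAtInfinity n) (𝓝 b)) : AsympEq A fun _ => b :=
  ⟨(const b).bdd, (isLittleO_one_iff ℝ).2 (by simpa using h.sub_const b)⟩

theorem eventually_abs_le {b δ : ℝ} (h : AsympEq A fun _ => b) (hδ : 0 < δ) :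
    ∀ᶠ x in sphereAtInfinity n, |A x - b| ≤ δ := by
  filter_upwards [h.tendsto (Metric.closedBall_mem_nhds b hδ)] with x hx
  simpa [Real.dist_eq] using hx

theorem of_abs_le {C τ : ℝ} (hB : B =O[sphereAtInfinity n] (fun _ => (1 : ℝ))) (hτ : 0 < τ)
    (h : ∀ᶠ x in sphereAtInfinity n, |A x - B x| ≤ C * ballRho x ^ τ) : AsympEq A B := by
  refine ⟨hB, (isLittleO_one_iff ℝ).2 (squeeze_zero_norm' h ?_)⟩
  have h1 : Tendsto (fun s : ℝ => C * s ^ τ) (𝓝[>] 0) (𝓝 0) := by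
    have := ((Real.continuousAt_rpow_const 0 τ (Or.inr hτ.le)).tendsto.const_mul C).mono_left
      (nhdsWithin_le_nhds (s := Ioi 0))
    simpa [Real.zero_rpow hτ.ne'] using this
  exact h1.comp tendsto_ballRho_sphereAtInfinity

theorem ballRho : AsympEq (n := n) ballRho (fun _ => 0) :=
  of_tendsto (tendsto_ballRho_sphereAtInfinity.mono_right nhdsWithin_le_nhds)

/-- Since `|x|² = 1 - 2ρ`. -/
theorem sum_coord_sq : AsympEq (n := n) (fun x => ∑ i, x i * x i) (fun _ => 1) := by
  have h := (const (n := n) 1).sub ((const 2).mul ballRho)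
  refine (h.congr_left (Eventually.of_forall fun x => ?_)).congr_right (fun x => by simp)
  rw [← norm_sq_eq_one_sub_ballRho, EuclideanSpace.real_norm_sq_eq]
  exact Finset.sum_congr rfl fun i _ => (sq _).symm

end AsympEq

end Asymptotics

/-! ### The rescaled geometry -/

section Rescaled

variable {n : ℕ} (g K : Euc n → Euc n →L[ℝ] Euc n →L[ℝ] ℝ) (U : Euc n → ℝ)

/-- The Kronecker delta. -/
def kron (i j : Fin n) : ℝ := if i = j then 1 else 0

/-- The inverse of the rescaled metric `ρ² g`. -/
noncomputable def scaledInv (x : Euc n) (i j : Fin n) : ℝ :=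
  (ballRho x ^ 2)⁻¹ * invMetric g x i j

/-- The gradient of `ρ` in the rescaled metric. -/
noncomputable def scaledGrad (x : Euc n) (i : Fin n) : ℝ := ∑ j, scaledInv g x i j * -x j

/-- The squared norm of `dρ` in the rescaled metric. -/
noncomputable def scaledGradSq (x : Euc n) : ℝ := ∑ i, scaledGrad g x i * -x i

/-- The contraction `ρ Γᵏᵢⱼ ρₖ`. -/
noncomputable def scaledChristoffel (x : Euc n) (i j : Fin n) : ℝ :=
  ∑ k, ballRho x * christoffel g k i j x * -x k

/-- The deviation of the rescaled first order part of the Jang operator from `-δ`. -/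
noncomputable def jangRemainder (x : Euc n) (i j : Fin n) : ℝ :=
  kron i j - ballRho x * U x * ballRho x * kron i j - ballRho x * U x * scaledChristoffel g x i j
    - ballRho x ^ 2 * pderiv i U x * x j - ballRho x ^ 2 * pderiv j U x * x i

/-- The coefficients of the rescaled Jang operator at a radial function of slope `p`. -/
noncomputable def jangCoeff (p : ℝ) (x : Euc n) (i j : Fin n) : ℝ :=
  scaledInv g x i j - (ballRho x * U x) ^ 2 * p ^ 2 * scaledGrad g x i * scaledGrad g x j
    / (1 + (ballRho x * U x) ^ 2 * p ^ 2 * scaledGradSq g x)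

variable {g K U}

theorem invMetric_eq {x : Euc n} (hx : ballRho x ≠ 0) (i j : Fin n) :
    invMetric g x i j = ballRho x ^ 2 * scaledInv g x i j := by
  unfold scaledInv; field_simp

/-- The Jang operator at a radial function, in terms of the rescaled geometry. -/
theorem coordJang_radial {x : Euc n} (hx : ballRho x ≠ 0) {f : Euc n → ℝ} {p q : ℝ}
    (h₁ : ∀ i, pderiv i f x = p * -x i)
    (h₂ : ∀ i j, pderiv i (pderiv j f) x = q / ballRho x * (x i * x j) - p * kron i j)
    (hW : 0 < 1 + (ballRho x * U x) ^ 2 * p ^ 2 * scaledGradSq g x) :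
    coordJang g K U f x =
      (ballRho x * U x * q * scaledGradSq g x
            / (1 + (ballRho x * U x) ^ 2 * p ^ 2 * scaledGradSq g x)
          - p * ∑ i, jangCoeff g U p x i i
          + p * ∑ i, ∑ j, jangCoeff g U p x i j * jangRemainder g U x i j)
        / √(1 + (ballRho x * U x) ^ 2 * p ^ 2 * scaledGradSq g x)
      - ∑ i, ∑ j, jangCoeff g U p x i j * (ballRho x ^ 2 * comp₂ K x i j) := by
  have hgrad : ∀ i, gradComp g f i x = ballRho x ^ 2 * p * scaledGrad g x i := by
    intro i
    unfold gradComp scaledGrad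
    rw [Finset.mul_sum]
    refine Finset.sum_congr rfl fun j _ => ?_
    rw [invMetric_eq hx, h₁]; ring
  have hsq : U x ^ 2 * gradSq g f x = (ballRho x * U x) ^ 2 * p ^ 2 * scaledGradSq g x := by
    unfold gradSq scaledGradSq
    rw [Finset.mul_sum, Finset.mul_sum]
    refine Finset.sum_congr rfl fun i _ => ?_
    rw [hgrad, h₁]; ring
  have hhess : ∀ i j, hessComp g f i j x =
      q / ballRho x * (x i * x j) - p * kron i j
        - p / ballRho x * scaledChristoffel g x i j := by
    intro i j
    unfold hessComp scaledChristoffel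
    rw [h₂, Finset.mul_sum]
    congr 1
    refine Finset.sum_congr rfl fun k _ => ?_
    rw [h₁]; field_simp
  -- With `N = |dρ|²` and `k = (ρU)²p²`, the rank-one correction turns `N` into `N - kN²/(1+kN) =
  -- N/(1+kN)`; this damps the second derivative where the slope is large.
  have hcontr : ∑ i, ∑ j, jangCoeff g U p x i j * (x i * x j) =
      scaledGradSq g x / (1 + (ballRho x * U x) ^ 2 * p ^ 2 * scaledGradSq g x) := by
    have e1 : ∑ i, ∑ j, scaledInv g x i j * (x i * x j) = scaledGradSq g x := by
      unfold scaledGradSq scaledGrad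
      refine Finset.sum_congr rfl fun i _ => ?_
      rw [Finset.sum_mul]
      exact Finset.sum_congr rfl fun j _ => by ring
    have e2 : ∑ i, ∑ j, scaledGrad g x i * scaledGrad g x j * (x i * x j)
        = scaledGradSq g x ^ 2 := by
      unfold scaledGradSq
      rw [sq, Finset.sum_mul_sum]
      exact Finset.sum_congr rfl fun i _ => Finset.sum_congr rfl fun j _ => by ring
    have e3 : ∑ i, ∑ j, jangCoeff g U p x i j * (x i * x j) =
        ∑ i, ∑ j, scaledInv g x i j * (x i * x j)
          - (ballRho x * U x) ^ 2 * p ^ 2 / (1 + (ballRho x * U x) ^ 2 * p ^ 2 * scaledGradSq g x)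
            * ∑ i, ∑ j, scaledGrad g x i * scaledGrad g x j * (x i * x j) := by
      rw [Finset.mul_sum, ← Finset.sum_sub_distrib]
      refine Finset.sum_congr rfl fun i _ => ?_
      rw [Finset.mul_sum, ← Finset.sum_sub_distrib]
      refine Finset.sum_congr rfl fun j _ => ?_
      unfold jangCoeff; ring
    rw [e3, e1, e2]
    obtain ⟨D, hD⟩ : ∃ D, D = 1 + (ballRho x * U x) ^ 2 * p ^ 2 * scaledGradSq g x := ⟨_, rfl⟩
    rw [← hD] at hW ⊢
    have := hW.ne'
    field_simp
    rw [hD]; ring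
  have htrace : ∑ i, ∑ j, jangCoeff g U p x i j * kron i j = ∑ i, jangCoeff g U p x i i := by
    refine Finset.sum_congr rfl fun i _ => ?_
    simp [kron]
  unfold coordJang
  rw [hsq]
  set W := √(1 + (ballRho x * U x) ^ 2 * p ^ 2 * scaledGradSq g x)
  have hW0 : W ≠ 0 := (Real.sqrt_pos.2 hW).ne'
  have hterm : ∀ i j,
      (invMetric g x i j - U x ^ 2 * gradComp g f i x * gradComp g f j x
          / (1 + (ballRho x * U x) ^ 2 * p ^ 2 * scaledGradSq g x)) *
        ((U x * hessComp g f i j x + pderiv i U x * pderiv j f x + pderiv i f x * pderiv j U x) / W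
          - comp₂ K x i j)
      = ballRho x * U x * q / W * (jangCoeff g U p x i j * (x i * x j))
        - p / W * (jangCoeff g U p x i j * kron i j)
        + p / W * (jangCoeff g U p x i j * jangRemainder g U x i j)
        - jangCoeff g U p x i j * (ballRho x ^ 2 * comp₂ K x i j) := by
    intro i j
    have e1 : invMetric g x i j - U x ^ 2 * gradComp g f i x * gradComp g f j x
          / (1 + (ballRho x * U x) ^ 2 * p ^ 2 * scaledGradSq g x)
        = ballRho x ^ 2 * jangCoeff g U p x i j := by
      rw [invMetric_eq hx, hgrad, hgrad]; unfold jangCoeff; ring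
    have e2 : ballRho x ^ 2 * (U x * hessComp g f i j x + pderiv i U x * pderiv j f x
          + pderiv i f x * pderiv j U x)
        = ballRho x * U x * q * (x i * x j) - p * kron i j + p * jangRemainder g U x i j := by
      rw [hhess, h₁, h₁]; unfold jangRemainder
      field_simp
      ring
    rw [e1]
    calc _ = jangCoeff g U p x i j * (ballRho x ^ 2 * (U x * hessComp g f i j x
            + pderiv i U x * pderiv j f x + pderiv i f x * pderiv j U x)) / W
          - jangCoeff g U p x i j * (ballRho x ^ 2 * comp₂ K x i j) := by ring
      _ = _ := by rw [e2]; ring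
  simp only [hterm, Finset.sum_add_distrib, Finset.sum_sub_distrib, ← Finset.mul_sum]
  rw [hcontr, htrace]
  ring

theorem pderiv_neg (i : Fin n) (f : Euc n → ℝ) :
    pderiv i (fun x => -f x) = fun x => -pderiv i f x := by
  funext x
  simp [pderiv, fderiv_fun_neg]

/-- The terms with derivatives of `f` in the second factor are odd in `f`, while `|df|²` and `fⁱfʲ`
are even, so only the sign of `K` distinguishes the two sides. This reduces the lower barrier to the
upper one. -/
theorem coordJang_neg (f : Euc n → ℝ) (x : Euc n) :
    coordJang g K U (fun y => -f y) x = -coordJang g (fun y => -K y) U f x := by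
  have hgrad : ∀ i, gradComp g (fun y => -f y) i x = -gradComp g f i x := by
    intro i; simp [gradComp, pderiv_neg]
  have hsq : gradSq g (fun y => -f y) x = gradSq g f x := by
    simp [gradSq, hgrad, pderiv_neg]
  have hhess : ∀ i j, hessComp g (fun y => -f y) i j x = -hessComp g f i j x := by
    intro i j; simp [hessComp, pderiv_neg]; ring
  unfold coordJang
  rw [hsq, ← Finset.sum_neg_distrib]
  refine Finset.sum_congr rfl fun i _ => ?_
  rw [← Finset.sum_neg_distrib]
  refine Finset.sum_congr rfl fun j _ => ?_
  rw [hgrad, hgrad, hhess, pderiv_neg, pderiv_neg]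
  simp only [comp₂, Matrix.of_apply, neg_apply]
  ring

end Rescaled

/-! ### Limits of the rescaled geometry and the sign of the Jang operator -/

section RescaledLimits

variable {n : ℕ} {g K : Euc n → Euc n →L[ℝ] Euc n →L[ℝ] ℝ} {U : Euc n → ℝ}

/-- The rescaled metric and lapse, and their first derivatives, are asymptotic to those of the
model. -/
structure HasModelAsymptotics (g : Euc n → Euc n →L[ℝ] Euc n →L[ℝ] ℝ) (U : Euc n → ℝ) :
    Prop where
  metric : ∀ i j, AsympEq (fun x => ballRho x ^ 2 * comp₂ g x i j) (fun _ => kron i j)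
  deriv_metric : ∀ l i j, AsympEq (fun x => ballRho x ^ 3 * pderiv l (fun y => comp₂ g y i j) x)
    (fun x => 2 * x l * kron i j)
  lapse : AsympEq (fun x => ballRho x * U x) (fun _ => 1)
  deriv_lapse : ∀ i, AsympEq (fun x => ballRho x ^ 2 * pderiv i U x) (fun x => x i)

namespace HasModelAsymptotics

variable (h : HasModelAsymptotics g U)
include h

/-- By Cramer's formula: determinant and adjugate are continuous, and `ρ²g` tends to the identity
matrix. -/
theorem scaledInv (i j : Fin n) :
    AsympEq (fun x => scaledInv g x i j) (fun _ => kron i j) := by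
  have hA : Tendsto (fun x => ballRho x ^ 2 • comp₂ g x) (sphereAtInfinity n)
      (𝓝 (1 : Matrix (Fin n) (Fin n) ℝ)) := by
    refine tendsto_pi_nhds.2 fun i => tendsto_pi_nhds.2 fun j => ?_
    have := (h.metric i j).tendsto
    simpa [Matrix.one_apply, kron] using this
  have hdet : Tendsto (fun x => (ballRho x ^ 2 • comp₂ g x).det) (sphereAtInfinity n) (𝓝 1) := by
    have := ((continuous_id.matrix_det (R := ℝ) (n := Fin n)).tendsto 1).comp hA
    simp only [id, Matrix.det_one] at this
    exact this
  have hadj : Tendsto (fun x => (ballRho x ^ 2 • comp₂ g x).adjugate i j) (sphereAtInfinity n)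
      (𝓝 (kron i j)) := by
    have := (((continuous_id.matrix_adjugate (R := ℝ) (n := Fin n)).matrix_elem i j).tendsto
      1).comp hA
    simp only [id, Matrix.adjugate_one, Matrix.one_apply] at this
    exact this
  have hlim : Tendsto (fun x => (ballRho x ^ 2 • comp₂ g x).det⁻¹ *
      (ballRho x ^ 2 • comp₂ g x).adjugate i j) (sphereAtInfinity n) (𝓝 (kron i j)) := by
    simpa using (hdet.inv₀ one_ne_zero).mul hadj
  refine (AsympEq.of_tendsto hlim).congr_left ?_
  filter_upwards [eventually_ballRho_pos, hdet.eventually_ne one_ne_zero] with x hx hd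
  have hinv : invMetric g x = ballRho x ^ 2 • (ballRho x ^ 2 • comp₂ g x)⁻¹ := by
    refine Matrix.inv_eq_right_inv ?_
    rw [Matrix.mul_smul, ← Matrix.smul_mul]
    exact Matrix.mul_nonsing_inv _ (isUnit_iff_ne_zero.2 hd)
  unfold _root_.scaledInv
  rw [hinv, Matrix.inv_def, Ring.inverse_eq_inv']
  simp only [Matrix.smul_apply, smul_eq_mul]
  field_simp

theorem scaledGrad (i : Fin n) : AsympEq (fun x => scaledGrad g x i) (fun x => -x i) := by
  have := AsympEq.sum (s := Finset.univ)
    fun j _ => (h.scaledInv i j).mul (AsympEq.coord j).neg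
  exact this.congr_right fun x => by simp [kron]

theorem scaledGradSq : AsympEq (fun x => scaledGradSq g x) (fun _ => 1) := by
  have := AsympEq.sum (s := Finset.univ) fun i _ => (h.scaledGrad i).mul (AsympEq.coord i).neg
  exact (this.congr_right fun x => by simp).trans AsympEq.sum_coord_sq

theorem norm_scaledGrad :
    AsympEq (fun x => ∑ i, _root_.scaledGrad g x i * _root_.scaledGrad g x i) (fun _ => 1) := by
  have := AsympEq.sum (s := Finset.univ) fun i _ => (h.scaledGrad i).mul (h.scaledGrad i)
  exact (this.congr_right fun x => by simp).trans AsympEq.sum_coord_sq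

theorem trace_scaledInv :
    AsympEq (fun x => ∑ i, _root_.scaledInv g x i i) (fun _ => (n : ℝ)) := by
  have := AsympEq.sum (s := Finset.univ) fun i _ => h.scaledInv i i
  exact this.congr_right fun x => by simp [kron]

theorem christoffel (k i j : Fin n) : AsympEq (fun x => ballRho x * christoffel g k i j x)
    (fun x => x i * kron k j + x j * kron k i - x k * kron i j) := by
  have := (AsympEq.const (n := n) (1 / 2)).mul (AsympEq.sum (s := Finset.univ)
    fun l _ => (h.scaledInv k l).mul
      (((h.deriv_metric i j l).add (h.deriv_metric j i l)).sub (h.deriv_metric l i j)))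
  refine (this.congr_left ?_).congr_right fun x => ?_
  · filter_upwards [eventually_ballRho_pos] with x hx
    unfold _root_.christoffel
    rw [← mul_assoc, mul_comm (ballRho x), mul_assoc, Finset.mul_sum]
    congr 1
    refine Finset.sum_congr rfl fun l _ => ?_
    rw [invMetric_eq hx.ne']; ring
  · have : ∀ l, kron k l * (2 * x i * kron j l + 2 * x j * kron i l - 2 * x l * kron i j)
        = if k = l then 2 * x i * kron j l + 2 * x j * kron i l - 2 * x l * kron i j else 0 := by
      intro l; simp [kron]
    simp only [this, Finset.sum_ite_eq, Finset.mem_univ, if_true]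
    simp only [kron, eq_comm (a := k)]
    ring

/-- Contracts the Christoffel symbols of the conformally flat model with `dρ = -x` and uses `|x|² →
1`. -/
theorem scaledChristoffel (i j : Fin n) : AsympEq (fun x => scaledChristoffel g x i j)
    (fun x => kron i j - 2 * (x i * x j)) := by
  have h1 := AsympEq.sum (s := Finset.univ)
    fun k _ => (h.christoffel k i j).mul (AsympEq.coord k).neg
  have h2 := ((AsympEq.const (n := n) (kron i j)).mul AsympEq.sum_coord_sq).sub
    ((AsympEq.const 2).mul ((AsympEq.coord i).mul (AsympEq.coord j)))
  refine (h1.congr_right fun x => ?_).trans (h2.congr_right fun x => by ring)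
  have e : ∀ k, (x i * kron k j + x j * kron k i - x k * kron i j) * -x k
      = kron i j * (x k * x k) - ((if k = j then x i * x k else 0)
        + if k = i then x j * x k else 0) := by
    intro k
    unfold kron
    split_ifs <;> ring
  simp only [e, Finset.sum_sub_distrib, Finset.sum_add_distrib, ← Finset.mul_sum,
    Finset.sum_ite_eq', Finset.mem_univ, if_true]
  ring

/-- The term `2xᵢxⱼ` from the Christoffel symbols cancels against the two terms with the gradient of
`u`, where `ρ²uᵢ → xᵢ`; the remaining `δᵢⱼ` cancel as well. Thus the first-order part of the
operator is asymptotically `-p δᵢⱼ`. -/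
theorem jangRemainder (i j : Fin n) : AsympEq (fun x => jangRemainder g U x i j)
    (fun _ => 0) := by
  have hk := AsympEq.const (n := n) (kron i j)
  have := (((hk.sub ((h.lapse.mul AsympEq.ballRho).mul hk)).sub
    (h.lapse.mul (h.scaledChristoffel i j))).sub ((h.deriv_lapse i).mul (AsympEq.coord j))).sub
    ((h.deriv_lapse j).mul (AsympEq.coord i))
  exact this.congr_right fun x => by ring

end HasModelAsymptotics

/-- The scalar inequality behind the barrier property. -/
theorem jang_bracket_le {δ A₁ A₂ μ t S p z c τ N : ℝ} (hδ : δ ≤ 1 / 2)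
    (h₁ : |A₁ - 1| ≤ δ) (h₂ : |A₂ - 1| ≤ δ) (hμ : |μ - 1| ≤ δ) (ht : |t - N| ≤ δ) (hS : |S| ≤ δ)
    (hz : 0 ≤ z) (hzτ : z ≤ τ) (hmain : z - N + p ^ 2 / (1 + p ^ 2) ≤ -c) :
    A₁ * z * ((1 + p ^ 2) / (1 + μ * p ^ 2)) - t + A₂ * (p ^ 2 / (1 + μ * p ^ 2)) + S
      ≤ -c + (4 * τ + 6) * δ := by
  rw [abs_le] at h₁ h₂ hμ ht hS
  have hδ0 : 0 ≤ δ := by linarith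
  have hp : 0 ≤ p ^ 2 := sq_nonneg p
  have hμ0 : 0 < 1 + μ * p ^ 2 := by nlinarith
  set θ := (1 + p ^ 2) / (1 + μ * p ^ 2)
  have hθ0 : 0 ≤ θ := by positivity
  -- Uniform in `p`: as `μ ≥ 1 - δ` and `δ ≤ 1/2`, one has `(1 + 2δ)μ ≥ 1`.
  have hθ : θ ≤ 1 + 2 * δ := by
    rw [div_le_iff₀ hμ0]
    have h1 : 1 ≤ (1 + 2 * δ) * μ := by nlinarith
    nlinarith [mul_le_mul_of_nonneg_right h1 hp]
  have hη : p ^ 2 / (1 + μ * p ^ 2) = p ^ 2 / (1 + p ^ 2) * θ := by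
    simp only [θ]; field_simp
  have hξ0 : 0 ≤ p ^ 2 / (1 + p ^ 2) := by positivity
  have hξ1 : p ^ 2 / (1 + p ^ 2) ≤ 1 := by rw [div_le_one (by positivity)]; linarith
  rw [hη]
  set ξ := p ^ 2 / (1 + p ^ 2)
  have key : ∀ A, A ≤ 1 + δ → A * θ ≤ 1 + 4 * δ := by
    intro A hA
    calc A * θ ≤ (1 + δ) * (1 + 2 * δ) := by
          refine (mul_le_mul_of_nonneg_right hA hθ0).trans ?_
          gcongr
      _ ≤ _ := by nlinarith
  have k₁ : A₁ * z * θ ≤ z + 4 * δ * τ := by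
    have := mul_le_mul_of_nonneg_right (key A₁ (by linarith)) hz
    have := mul_le_mul_of_nonneg_left hzτ hδ0
    nlinarith
  have k₂ : A₂ * (ξ * θ) ≤ ξ + 4 * δ := by
    have := mul_le_mul_of_nonneg_right (key A₂ (by linarith)) hξ0
    have := mul_le_mul_of_nonneg_left hξ1 hδ0
    nlinarith
  -- The error `(4τ + 6)δ` collects `4τδ` from `k₁`, `4δ` from `k₂`, and one `δ` each from `t` and
  -- `S`.
  linarith

/-- After factoring out `p/W`, with `W` the square root, the bracket is at most `-c/2`. As `W ≤
2√(1+p²)`, the term `T` is at most `(c/8)·2·p/W = (c/4) p/W` in absolute value, so half of the gain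
survives. The letter `s` stands for `ρ^τ`. -/
theorem jang_value_neg {δ τ c m v N Y t d S T p z s : ℝ} (hδ : δ ≤ 1 / 2)
    (hδc : (4 * τ + 6) * δ ≤ c / 2) (hc : 0 < c) (hm : 0 < m) (hp : 0 < p)
    (h₁ : |v * N - 1| ≤ δ) (h₂ : |v * v * Y - 1| ≤ δ) (hμ : |v * v * N - 1| ≤ δ)
    (ht : |t - d| ≤ δ) (hS : |S| ≤ δ) (hT : |T| ≤ m * s)
    (hz : 0 ≤ z) (hzτ : z ≤ τ) (hmain : z - d + p ^ 2 / (1 + p ^ 2) ≤ -c)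
    (hs : s ≤ c / (8 * m) * (p / √(1 + p ^ 2))) :
    (v * (p * (1 + p ^ 2) * z) * N / (1 + v ^ 2 * p ^ 2 * N)
      - p * (t - v * v * Y * (p ^ 2 / (1 + v ^ 2 * p ^ 2 * N))) + p * S)
        / √(1 + v ^ 2 * p ^ 2 * N) - T < 0 := by
  have hbr := jang_bracket_le hδ h₁ h₂ hμ ht hS hz hzτ hmain
  have hμ' := abs_le.1 hμ
  have hp2 : 0 < p ^ 2 := by positivity
  have hμp : v ^ 2 * p ^ 2 * N = v * v * N * p ^ 2 := by ring
  rw [hμp]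
  set μ := v * v * N
  have hW : 0 < 1 + μ * p ^ 2 := by nlinarith
  have hW2 : 1 + μ * p ^ 2 ≤ 2 ^ 2 * (1 + p ^ 2) := by nlinarith
  set W := √(1 + μ * p ^ 2)
  have hWpos : 0 < W := Real.sqrt_pos.2 hW
  have hWle : W ≤ 2 * √(1 + p ^ 2) := by
    rw [← Real.sqrt_sq (zero_le_two (α := ℝ)), ← Real.sqrt_mul (by norm_num)]
    exact Real.sqrt_le_sqrt hW2
  have hsq : 0 < √(1 + p ^ 2) := Real.sqrt_pos.2 (by positivity)
  have hpW : p / √(1 + p ^ 2) ≤ 2 * (p / W) := by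
    rw [div_le_iff₀ hsq, mul_div_assoc', div_mul_eq_mul_div, le_div_iff₀ hWpos]
    have := mul_le_mul_of_nonneg_left hWle hp.le
    linarith
  have e : (v * (p * (1 + p ^ 2) * z) * N / (1 + μ * p ^ 2)
      - p * (t - v * v * Y * (p ^ 2 / (1 + μ * p ^ 2))) + p * S) / W
      = p / W * (v * N * z * ((1 + p ^ 2) / (1 + μ * p ^ 2)) - t
        + v * v * Y * (p ^ 2 / (1 + μ * p ^ 2)) + S) := by ring
  rw [e]
  have hpW0 : 0 < p / W := by positivity
  have f1 := mul_le_mul_of_nonneg_left (hbr.trans (by linarith : _ ≤ -(c / 2))) hpW0.le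
  have f2 : m * s ≤ c / 8 * (p / √(1 + p ^ 2)) := by
    calc m * s ≤ m * (c / (8 * m) * (p / √(1 + p ^ 2))) := by gcongr
      _ = _ := by field_simp
  have f3 := (abs_le.1 hT).1
  have f4 : c / 8 * (p / √(1 + p ^ 2)) ≤ c / 8 * (2 * (p / W)) := by gcongr
  have f5 : 0 < c * (p / W) := mul_pos hc hpW0
  linarith

/-- Near infinity the Jang operator is negative on radial functions whose slope satisfies the
model differential inequality. -/
theorem eventually_coordJang_neg (h : HasModelAsymptotics g U) {τ c C : ℝ} (hτ : 0 ≤ τ)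
    (hc : 0 < c) (hC : 0 < C)
    (hK : ∀ i j, ∀ᶠ x in sphereAtInfinity n, |ballRho x ^ 2 * comp₂ K x i j| ≤ C * ballRho x ^ τ) :
    ∃ ε > 0, ∀ᶠ x in sphereAtInfinity n, ∀ (f : Euc n → ℝ) (p q z : ℝ), 0 < p →
      (∀ i, pderiv i f x = p * -x i) →
      (∀ i j, pderiv i (pderiv j f) x = q / ballRho x * (x i * x j) - p * kron i j) →
      q = p * (1 + p ^ 2) * z → 0 ≤ z → z ≤ τ → z - n + p ^ 2 / (1 + p ^ 2) ≤ -c →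
      ballRho x ^ τ ≤ ε * (p / √(1 + p ^ 2)) → coordJang g K U f x < 0 := by
  set δ := min (1 / 2) (c / (2 * (4 * τ + 6)))
  have hδ : 0 < δ := by positivity
  have hδ2 : (4 * τ + 6) * δ ≤ c / 2 := by
    calc (4 * τ + 6) * δ ≤ (4 * τ + 6) * (c / (2 * (4 * τ + 6))) := by
          gcongr; exact min_le_right _ _
      _ = c / 2 := by field_simp
  -- Each coefficient is at most `2 + 4·2·(2·2) = 34` in absolute value, whatever `p` is, and there
  -- are `n²` of them; the `+ 1` ensures positivity.
  set m : ℝ := 34 * C * (n * n) + 1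
  have hm : 0 < m := by positivity
  have hR := (AsympEq.sum (s := Finset.univ) fun i (_ : i ∈ Finset.univ) =>
    AsympEq.sum (s := Finset.univ) fun j (_ : j ∈ Finset.univ) =>
      AsympEq.of_tendsto (h.jangRemainder i j).tendsto.abs).congr_right
        (B' := fun _ => 0) fun x => by simp
  have hμ := ((h.lapse.mul h.lapse).mul h.scaledGradSq).congr_right
    (B' := fun _ => 1) fun x => by norm_num
  have hA₁ := (h.lapse.mul h.scaledGradSq).congr_right (B' := fun _ => 1) fun x => by norm_num
  have hA₂ := ((h.lapse.mul h.lapse).mul h.norm_scaledGrad).congr_right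
    (B' := fun _ => 1) fun x => by norm_num
  have hX : ∀ᶠ x in sphereAtInfinity n, ∀ i, |scaledGrad g x i| ≤ 2 := by
    refine eventually_all.2 fun i => ?_
    have h1 := ((h.scaledGrad i).sub (AsympEq.coord i).neg).congr_right
      (B' := fun _ => 0) fun x => by ring
    filter_upwards [h1.eventually_abs_le one_pos, eventually_ballRho_pos] with x h1 h2
    have h3 := (PiLp.norm_apply_le x i).trans (ballRho_pos_iff.1 h2).le
    rw [Real.norm_eq_abs] at h3
    rw [abs_le] at *
    constructor <;> linarith
  have hG : ∀ᶠ x in sphereAtInfinity n, ∀ i j, |scaledInv g x i j| ≤ 2 := by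
    refine eventually_all.2 fun i => eventually_all.2 fun j => ?_
    filter_upwards [(h.scaledInv i j).eventually_abs_le one_pos] with x h1
    have h2 : |kron i j| ≤ 1 := by unfold kron; split_ifs <;> simp
    rw [abs_le] at *
    constructor <;> linarith
  have hK' : ∀ᶠ x in sphereAtInfinity n, ∀ i j,
      |ballRho x ^ 2 * comp₂ K x i j| ≤ C * ballRho x ^ τ :=
    eventually_all.2 fun i => eventually_all.2 fun j => hK i j
  refine ⟨c / (8 * m), by positivity, ?_⟩
  filter_upwards [eventually_ballRho_pos, hR.eventually_abs_le (δ := δ / 34) (by positivity),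
    hμ.eventually_abs_le hδ, hA₁.eventually_abs_le hδ, hA₂.eventually_abs_le hδ,
    h.trace_scaledInv.eventually_abs_le hδ, hX, hG, hK', h.lapse.eventually_abs_le one_pos]
    with x hρ hR hμ hA₁ hA₂ ht hX hG hK hv f p q z hp h₁ h₂ hq hz hzτ hmain hε
  set v := ballRho x * U x with hvdef
  set N := scaledGradSq g x
  have hδh : δ ≤ 1 / 2 := min_le_left _ _
  have hμ' := abs_le.1 hμ
  have hp2 : 0 < p ^ 2 := by positivity
  have hμp : v ^ 2 * p ^ 2 * N = v * v * N * p ^ 2 := by ring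
  have hW1 : 1 + p ^ 2 ≤ 2 * (1 + v ^ 2 * p ^ 2 * N) := by rw [hμp]; nlinarith
  have hW : 0 < 1 + v ^ 2 * p ^ 2 * N := by linarith
  rw [coordJang_radial hρ.ne' h₁ h₂ hW]
  have hη : |p ^ 2 / (1 + v ^ 2 * p ^ 2 * N)| ≤ 2 := by
    rw [abs_of_pos (by positivity), div_le_iff₀ hW]; linarith
  have hv2 : |v ^ 2| ≤ 4 := by
    rw [abs_pow]
    have : |v| ≤ 2 := by rw [abs_le] at *; constructor <;> linarith
    nlinarith [abs_nonneg v]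
  have ha : ∀ i j, |jangCoeff g U p x i j| ≤ 34 := by
    intro i j
    have e : jangCoeff g U p x i j = scaledInv g x i j - v ^ 2 *
        (p ^ 2 / (1 + v ^ 2 * p ^ 2 * N)) * (scaledGrad g x i * scaledGrad g x j) := by
      unfold jangCoeff; ring
    rw [e]
    refine (abs_sub _ _).trans ?_
    rw [abs_mul, abs_mul, abs_mul]
    calc _ ≤ 2 + 4 * 2 * (2 * 2 : ℝ) := by
          gcongr
          · exact hG i j
          · exact hX i
          · exact hX j
      _ = 34 := by norm_num
  have hS : |∑ i, ∑ j, jangCoeff g U p x i j * jangRemainder g U x i j| ≤ δ := by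
    rw [sub_zero] at hR
    refine (Finset.abs_sum_le_sum_abs _ _).trans ?_
    calc _ ≤ ∑ i, 34 * ∑ j, |jangRemainder g U x i j| := by
          refine Finset.sum_le_sum fun i _ => (Finset.abs_sum_le_sum_abs _ _).trans ?_
          rw [Finset.mul_sum]
          refine Finset.sum_le_sum fun j _ => ?_
          rw [abs_mul]
          gcongr
          exact ha i j
      _ = 34 * ∑ i, ∑ j, |jangRemainder g U x i j| := by rw [Finset.mul_sum]
      _ ≤ 34 * (δ / 34) := by gcongr; exact (le_abs_self _).trans hR
      _ = δ := by ring
  have hKs : |∑ i, ∑ j, jangCoeff g U p x i j * (ballRho x ^ 2 * comp₂ K x i j)|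
      ≤ m * ballRho x ^ τ := by
    have hρτ : 0 ≤ ballRho x ^ τ := Real.rpow_nonneg hρ.le _
    refine (Finset.abs_sum_le_sum_abs _ _).trans ?_
    calc _ ≤ ∑ _i : Fin n, ∑ _j : Fin n, 34 * (C * ballRho x ^ τ) := by
          refine Finset.sum_le_sum fun i _ => (Finset.abs_sum_le_sum_abs _ _).trans
            (Finset.sum_le_sum fun j _ => ?_)
          rw [abs_mul]
          gcongr
          · exact ha i j
          · exact hK i j
      _ = 34 * C * (n * n) * ballRho x ^ τ := by simp; ring
      _ ≤ _ := by simp only [m]; nlinarith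
  have htr : ∑ i, jangCoeff g U p x i i = ∑ i, scaledInv g x i i
      - v * v * (∑ i, scaledGrad g x i * scaledGrad g x i)
        * (p ^ 2 / (1 + v ^ 2 * p ^ 2 * N)) := by
    rw [Finset.mul_sum, Finset.sum_mul, ← Finset.sum_sub_distrib]
    refine Finset.sum_congr rfl fun i _ => ?_
    unfold jangCoeff; ring
  rw [htr, hq]
  exact jang_value_neg hδh hδ2 hc hm hp hA₁ hA₂ hμ ht hS hKs hz hzτ hmain hε

end RescaledLimits

/-! ### Asymptotics of the data -/

section Data

variable {n : ℕ}

theorem IsWeightedHolder.congr {F : Type*} [NormedAddCommGroup F] [NormedSpace ℝ F]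
    {m k : ℕ} {α τ : ℝ} {Ω : Set (Euc n)} {T T' : Euc n → F} (h : IsWeightedHolder m k α τ Ω T)
    (hΩ : IsOpen Ω) (hT : EqOn T' T Ω) : IsWeightedHolder m k α τ Ω T' := by
  have key : ∀ y ∈ Ω, ∀ j, iteratedFDeriv ℝ j T' y = iteratedFDeriv ℝ j T y := fun y hy j =>
    (Filter.EventuallyEq.iteratedFDeriv (𝕜 := ℝ)
      (Filter.eventuallyEq_of_mem (hΩ.mem_nhds hy) hT) j).self_of_nhds
  obtain ⟨h, C, hC⟩ := h
  refine ⟨h.congr hT, C, fun x hx hsub => ⟨fun j hj y hy => ?_, fun y hy z hz => ?_⟩⟩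
  · rw [key y (hsub hy)]
    exact (hC x hx hsub).1 j hj y hy
  · rw [key y (hsub hy), key z (hsub hz)]
    exact (hC x hx hsub).2 y hy z hz

theorem IsWeightedHolder.eventually_comp₂_le {k : ℕ} {α τ r : ℝ} {Ω : Set (Euc n)}
    {T : Euc n → Euc n →L[ℝ] Euc n →L[ℝ] ℝ} (h : IsWeightedHolder 2 k α τ Ω T) (hr : 0 < r)
    (hΩ : rhoLT n r ⊆ Ω) : ∃ C > 0, ∀ i j, ∀ᶠ x in sphereAtInfinity n,
      |ballRho x ^ 2 * comp₂ T x i j| ≤ C * ballRho x ^ τ := by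
  obtain ⟨C, hC, h⟩ := h.eventually_le hr hΩ
  refine ⟨C, hC, fun i j => ?_⟩
  filter_upwards [h 0 (Nat.zero_le _), eventually_ballRho_pos] with x hx hρ
  rw [norm_iteratedFDeriv_zero, add_zero] at hx
  rw [abs_mul, abs_of_pos (by positivity)]
  refine le_trans ?_ hx
  gcongr
  have := (T x).le_opNorm₂ (EuclideanSpace.single i 1) (EuclideanSpace.single j 1)
  simpa [comp₂] using this

theorem comp₂_hypMetric (x : Euc n) (i j : Fin n) :
    comp₂ hypMetric x i j = (ballRho x ^ 2)⁻¹ * kron i j := by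
  change (ballRho x ^ 2)⁻¹ * inner ℝ (EuclideanSpace.single i (1 : ℝ))
    (EuclideanSpace.single j (1 : ℝ)) = _
  simp [kron, EuclideanSpace.inner_single_left, PiLp.single_apply]

theorem hasFDerivAt_comp_ballRho {φ : ℝ → ℝ} {φ' : ℝ} {x : Euc n}
    (h : HasDerivAt φ φ' (ballRho x)) :
    HasFDerivAt (fun y => φ (ballRho y)) (-φ' • euclInner n x) x := by
  refine (h.comp_hasFDerivAt x (hasFDerivAt_ballRho x)).congr_fderiv ?_
  ext v; simp

theorem euclInner_single (x : Euc n) (i : Fin n) :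
    euclInner n x (EuclideanSpace.single i 1) = x i := by
  simp [EuclideanSpace.inner_single_right]

/-- The weights `ρ²` and `ρ³` on a 2-tensor and its derivative are those of the rescaled metric,
with `∂ₗρ⁻² = 2xₗρ⁻³` giving the model term. For the lapse, boundedness of `u - 1/ρ` and of `ρ`
times its derivative leaves one spare factor `ρ`, hence decay of order one. -/
theorem HasModelAsymptotics.of_isWeightedHolder {α τ β r : ℝ} {Ω : Set (Euc n)} (hr : 0 < r)
    (hΩ : rhoLT n r ⊆ Ω) (hτ : 0 < τ) {g : Euc n → Euc n →L[ℝ] Euc n →L[ℝ] ℝ} {U : Euc n → ℝ}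
    (hg : IsWeightedHolder 2 1 α τ Ω (fun x => g x - hypMetric x))
    (hU : IsWeightedHolder 0 1 β 0 (rhoLT n r) (fun x => U x - (ballRho x)⁻¹)) :
    HasModelAsymptotics g U := by
  obtain ⟨C, hC, hCg⟩ := hg.eventually_le hr hΩ
  obtain ⟨B, hB, hBU⟩ := hU.eventually_le hr subset_rfl
  have hnhds : ∀ᶠ x in sphereAtInfinity n, rhoLT n r ∈ 𝓝 x :=
    (eventually_mem_rhoLT hr).mono fun x hx => (isOpen_rhoLT r).mem_nhds hx
  have hsplit : ∀ x i j, comp₂ g x i j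
      = (ballRho x ^ 2)⁻¹ * kron i j + comp₂ (fun x => g x - hypMetric x) x i j := by
    intro x i j
    rw [← comp₂_hypMetric]; simp [comp₂]
  constructor
  · intro i j
    obtain ⟨C', -, h⟩ := hg.eventually_comp₂_le hr hΩ
    refine AsympEq.of_abs_le (C := C') (AsympEq.const _).bdd hτ ?_
    filter_upwards [h i j, eventually_ballRho_pos] with x hx hρ
    rw [hsplit, mul_add, ← mul_assoc, mul_inv_cancel₀ (by positivity), one_mul, add_sub_cancel_left]
    exact hx
  · intro l i j
    refine AsympEq.of_abs_le (C := C)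
      (((AsympEq.const 2).mul (AsympEq.coord l)).mul (AsympEq.const _)).bdd hτ ?_
    filter_upwards [hCg 1 le_rfl, eventually_ballRho_pos, hnhds] with x hx hρ hmem
    rw [norm_iteratedFDeriv_one] at hx
    set T := fun x => g x - hypMetric x
    have hT : HasFDerivAt T (fderiv ℝ T x) x :=
      (((hg.1.mono hΩ).contDiffAt hmem).differentiableAt (by norm_num)).hasFDerivAt
    have hT' : HasFDerivAt (fun y => comp₂ T y i j)
        ((((ContinuousLinearMap.apply ℝ ℝ (EuclideanSpace.single j (1 : ℝ))).comp
          (ContinuousLinearMap.apply ℝ (Euc n →L[ℝ] ℝ) (EuclideanSpace.single i (1 : ℝ)))).comp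
          (fderiv ℝ T x))) x :=
      ((ContinuousLinearMap.apply ℝ ℝ (EuclideanSpace.single j (1 : ℝ))).comp
          (ContinuousLinearMap.apply ℝ (Euc n →L[ℝ] ℝ)
            (EuclideanSpace.single i (1 : ℝ)))).hasFDerivAt.comp x hT
    have hinv : HasDerivAt (fun s : ℝ => (s ^ 2)⁻¹ * kron i j)
        (-2 / ballRho x ^ 3 * kron i j) (ballRho x) := by
      refine (((hasDerivAt_pow 2 (ballRho x)).fun_inv (by positivity)).mul_const _).congr_deriv ?_
      congr 1
      field_simp
      norm_num
      ring
    have hfull := (hasFDerivAt_comp_ballRho hinv).add hT'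
    have e : pderiv l (fun y => comp₂ g y i j) x = 2 / ballRho x ^ 3 * kron i j * x l
        + fderiv ℝ T x (EuclideanSpace.single l 1) (EuclideanSpace.single i 1)
          (EuclideanSpace.single j 1) := by
      have e1 : (fun y => comp₂ g y i j) = (fun y => (ballRho y ^ 2)⁻¹ * kron i j) +
          fun y => comp₂ T y i j := funext fun y => hsplit y i j
      unfold pderiv
      rw [e1, hfull.fderiv]
      simp only [add_apply, smul_apply, euclInner_single,
        ContinuousLinearMap.comp_apply, ContinuousLinearMap.apply_apply, smul_eq_mul]
      ring
    rw [e]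
    have e2 : ballRho x ^ 3 * (2 / ballRho x ^ 3 * kron i j * x l
        + fderiv ℝ T x (EuclideanSpace.single l 1) (EuclideanSpace.single i 1)
          (EuclideanSpace.single j 1)) - 2 * x l * kron i j
        = ballRho x ^ 3 * fderiv ℝ T x (EuclideanSpace.single l 1) (EuclideanSpace.single i 1)
          (EuclideanSpace.single j 1) := by
      field_simp; ring
    rw [e2, abs_mul, abs_of_pos (by positivity)]
    refine le_trans ?_ hx
    gcongr
    have h1 := (fderiv ℝ T x (EuclideanSpace.single l 1)).le_opNorm₂
      (EuclideanSpace.single i 1) (EuclideanSpace.single j 1)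
    have h2 := (fderiv ℝ T x).le_opNorm (EuclideanSpace.single l 1)
    simp only [PiLp.norm_single, norm_one, mul_one] at h1 h2
    exact h1.trans h2
  · refine AsympEq.of_abs_le (C := B) (τ := 1) (AsympEq.const _).bdd one_pos ?_
    filter_upwards [hBU 0 (Nat.zero_le _), eventually_ballRho_pos] with x hx hρ
    rw [norm_iteratedFDeriv_zero, Real.rpow_zero, pow_zero, one_mul, Real.norm_eq_abs] at hx
    have e : ballRho x * U x - 1 = ballRho x * (U x - (ballRho x)⁻¹) := by field_simp
    rw [e, abs_mul, abs_of_pos hρ, Real.rpow_one, mul_comm]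
    gcongr
    simpa using hx
  · intro i
    refine AsympEq.of_abs_le (C := B) (τ := 1) (AsympEq.coord i).bdd one_pos ?_
    filter_upwards [hBU 1 le_rfl, eventually_ballRho_pos, hnhds] with x hx hρ hmem
    rw [norm_iteratedFDeriv_one, Real.rpow_zero, zero_add, pow_one] at hx
    set w := fun x => U x - (ballRho x)⁻¹
    have hw : HasFDerivAt w (fderiv ℝ w x) x :=
      ((hU.1.contDiffAt hmem).differentiableAt (by norm_num)).hasFDerivAt
    have hfull := (hasFDerivAt_comp_ballRho (hasDerivAt_inv hρ.ne')).add hw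
    have e : pderiv i U x = (ballRho x ^ 2)⁻¹ * x i
        + fderiv ℝ w x (EuclideanSpace.single i 1) := by
      have e1 : U = (fun y => (ballRho y)⁻¹) + w := by
        funext y; simp [w]
      unfold pderiv
      rw [e1, hfull.fderiv]
      simp only [add_apply, smul_apply, euclInner_single,
        smul_eq_mul, neg_neg]
    have e2 : ballRho x ^ 2 * ((ballRho x ^ 2)⁻¹ * x i
        + fderiv ℝ w x (EuclideanSpace.single i 1)) - x i
        = ballRho x * (ballRho x * fderiv ℝ w x (EuclideanSpace.single i 1)) := by
      field_simp; ring
    rw [e, e2, abs_mul, abs_of_pos hρ, Real.rpow_one, mul_comm]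
    gcongr
    rw [abs_mul, abs_of_pos hρ]
    refine le_trans ?_ (hx.trans (by simp))
    gcongr
    have h2 := (fderiv ℝ w x).le_opNorm (EuclideanSpace.single i 1)
    simpa only [PiLp.norm_single, norm_one, mul_one, Real.norm_eq_abs] using h2

theorem pderiv_radial {φ φ₁ : ℝ → ℝ} {F : Euc n → ℝ} {r : ℝ}
    (h₁ : ∀ s ∈ Ioo 0 r, HasDerivAt φ (φ₁ s) s)
    (hF : EqOn F (fun x => φ (ballRho x)) (rhoLT n r)) {x : Euc n} (hx : x ∈ rhoLT n r)
    (i : Fin n) : pderiv i F x = φ₁ (ballRho x) * -x i := by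
  unfold pderiv
  rw [(hasFDerivAt_radial h₁ hF hx).fderiv]
  simp only [smul_apply, euclInner_single, smul_eq_mul]
  ring

theorem pderiv_pderiv_radial {φ φ₁ φ₂ : ℝ → ℝ} {F : Euc n → ℝ} {r : ℝ}
    (h₁ : ∀ s ∈ Ioo 0 r, HasDerivAt φ (φ₁ s) s)
    (h₂ : ∀ s ∈ Ioo 0 r, HasDerivAt φ₁ (φ₂ s) s)
    (hF : EqOn F (fun x => φ (ballRho x)) (rhoLT n r)) {x : Euc n} (hx : x ∈ rhoLT n r)
    (i j : Fin n) : pderiv i (pderiv j F) x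
      = φ₂ (ballRho x) * (x i * x j) - φ₁ (ballRho x) * kron i j := by
  have h := (ContinuousLinearMap.apply ℝ ℝ (EuclideanSpace.single j (1 : ℝ))).hasFDerivAt.comp x
    (hasFDerivAt_fderiv_radial h₁ h₂ hF hx)
  have e : pderiv j F = (ContinuousLinearMap.apply ℝ ℝ (EuclideanSpace.single j (1 : ℝ))) ∘
      fderiv ℝ F := rfl
  rw [e]
  unfold pderiv
  rw [h.fderiv]
  simp [radialHess, kron, EuclideanSpace.inner_single_right, PiLp.single_apply, eq_comm]

theorem rhoDeriv_radial {φ φ₁ : ℝ → ℝ} {F : Euc n → ℝ} {r : ℝ}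
    (h₁ : ∀ s ∈ Ioo 0 r, HasDerivAt φ (φ₁ s) s)
    (hF : EqOn F (fun x => φ (ballRho x)) (rhoLT n r)) {x : Euc n} (hx : x ∈ rhoLT n r)
    (hx0 : x ≠ 0) : rhoDeriv F x = φ₁ (ballRho x) := by
  unfold rhoDeriv
  rw [(hasFDerivAt_radial h₁ hF hx).fderiv]
  have : ‖x‖ ≠ 0 := norm_ne_zero_iff.2 hx0
  simp only [smul_apply, euclInner_apply, inner_smul_right, real_inner_self_eq_norm_sq,
    smul_eq_mul]
  field_simp

end Data

/-! ### The barriers -/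

/-- The polar derivative `∂_ρ` is usable only away from the origin, which the chart at infinity
omits because `R₀ > 0`. -/
theorem zero_notMem_hypExterior {n : ℕ} {R : ℝ} (hR : 0 < R) : (0 : Euc n) ∉ hypExterior n R := by
  rintro ⟨-, h⟩
  simp [hypDist] at h
  linarith

section Main

variable {n : ℕ} {H : Type*} [TopologicalSpace H] {I : ModelWithCorners ℝ (Euc n) H}
  {M : Type*} [TopologicalSpace M] [ChartedSpace H M] {c : ChartAtInfinity I M}

theorem ChartAtInfinity.map_mem_rhoLT {r : ℝ} {p : M} (hp : p ∈ c.region r) :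
    c.Ψ p ∈ rhoLT n r := by
  have h := c.Ψ.map_source hp.1
  rw [c.target_eq] at h
  exact ⟨h.1, hp.2⟩

theorem ChartAtInfinity.ballRho_mem_Ioc {r : ℝ} {p : M} (hp : p ∈ c.closedRegion r) :
    ballRho (c.Ψ p) ∈ Ioc 0 r := by
  have h := c.Ψ.map_source hp.1
  rw [c.target_eq] at h
  exact ⟨ballRho_pos_iff.2 h.1, hp.2⟩

theorem ChartAtInfinity.ballRho_ne_zero_of_target {x : Euc n} (hx : x ∈ c.Ψ.target) : x ≠ 0 := by
  rintro rfl
  rw [c.target_eq] at hx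
  exact zero_notMem_hypExterior c.R₀_pos hx

theorem contMDiffOn_radial {φ : ℝ → ℝ} {r : ℝ} (hφ : ContDiffOn ℝ 2 φ (Ioo 0 r)) :
    ContMDiffOn I 𝓘(ℝ, ℝ) 2 (fun p => φ (ballRho (c.Ψ p))) (c.region r) := by
  have h1 : ContMDiffOn I 𝓘(ℝ, Euc n) 2 c.Ψ (c.region r) :=
    (c.smooth.of_le (WithTop.coe_le_coe.2 le_top)).mono fun p hp => hp.1
  have h2 : ContDiffOn ℝ 2 (fun x : Euc n => φ (ballRho x)) (rhoLT n r) :=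
    hφ.comp contDiff_ballRho.contDiffOn fun x hx => ballRho_mem_Ioo hx
  exact h2.contMDiffOn.comp h1 fun p hp => c.map_mem_rhoLT hp

theorem continuousOn_radial {φ : ℝ → ℝ} {r : ℝ} (hφ : ContinuousOn φ (Icc 0 r)) :
    ContinuousOn (fun p => φ (ballRho (c.Ψ p))) (c.closedRegion r) :=
  hφ.comp (continuous_ballRho.comp_continuousOn (c.Ψ.continuousOn.mono fun _ hp => hp.1))
    fun _ hp => Ioc_subset_Icc_self (c.ballRho_mem_Ioc hp)

end Main

theorem mainTheorem3 {n : ℕ} (hn : 3 ≤ n)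
    {H : Type*} [TopologicalSpace H] {I : ModelWithCorners ℝ (Euc n) H}
    {M : Type*} [TopologicalSpace M] [T2Space M] [SecondCountableTopology M]
    [ChartedSpace H M] [IsManifold I ∞ M]
    {α τ : ℝ} (hα : α ∈ Ioo (0 : ℝ) 1) (hτ : τ ∈ Ioo ((n : ℝ) / 2) n)
    (g K : BilinField I M) (c : ChartAtInfinity I M) (hdata : IsAsympAdS 1 α τ g K c)
    (u : M → ℝ) (r : ℝ) (hr : 0 < r) (hrc : rhoLT n r ⊆ c.Ψ.target)
    (hu : c.IsWeightedHolderFun 1 0 0 r (fun p => u p - (ballRho (c.Ψ p))⁻¹)) :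
    ∃ l ∈ Ioo (0 : ℝ) 1, ∃ r₁ > 0, ∀ ρ₀ ∈ Ioo 0 r₁,
      rhoLE n ρ₀ ⊆ rhoLT n r ∧
      ∃ f : M → ℝ,
        (∀ p ∈ c.closedRegion ρ₀, f p =
          ∫ s in (0 : ℝ)..ballRho (c.Ψ p), xiPlus n τ l ρ₀ s / √(1 - xiPlus n τ l ρ₀ s ^ 2)) ∧
        (∀ p ∈ c.region ρ₀, 0 < f p) ∧
        (∀ r' ∈ Ioo 0 ρ₀, c.IsWeightedHolderFun 2 α (τ + 1) r' f) ∧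
        IsUpperBarrier c g K u ρ₀ f ∧
        IsLowerBarrier c g K u ρ₀ (fun p => -f p) := by
  have hn' : (3 : ℝ) ≤ n := by exact_mod_cast hn
  set a : ℝ := (n : ℝ) / 2 with ha_def
  have ha : 1 ≤ a := by rw [ha_def]; linarith
  have haτ : a < τ := hτ.1
  have hτ0 : 0 < τ := by linarith
  -- Any `l` with `1/(1-l) < n/2` would do; `1/4` gives `4/3 < 3/2 ≤ n/2` for all `n ≥ 3`.
  obtain ⟨l, hl_def⟩ : ∃ l : ℝ, l = 1 / 4 := ⟨_, rfl⟩
  have hl : l ∈ Ioo (0 : ℝ) 1 := by rw [hl_def]; constructor <;> norm_num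
  set m := min (2 * a - τ) (a - (1 - l)⁻¹)
  have hm : 0 < m := by
    refine lt_min ?_ ?_
    · have := hτ.2; rw [ha_def]; linarith
    · rw [hl_def, ha_def]; norm_num; linarith
  set U : Euc n → ℝ := fun x => u (c.Ψ.symm x)
  have hmodel : HasModelAsymptotics (c.push g) U := by
    refine HasModelAsymptotics.of_isWeightedHolder hr hrc hτ0 (β := 0) hdata.decay_g
      (hu.congr (isOpen_rhoLT r) fun x hx => ?_)
    simp only [U, c.Ψ.right_inv (hrc hx)]
  obtain ⟨C, hC, hK⟩ := hdata.decay_K.eventually_comp₂_le hr hrc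
  have hK' : ∀ i j, ∀ᶠ x in sphereAtInfinity n,
      |ballRho x ^ 2 * comp₂ (fun y => -c.push K y) x i j| ≤ C * ballRho x ^ τ := by
    intro i j
    filter_upwards [hK i j] with x hx
    simpa [comp₂] using hx
  obtain ⟨ε, hε, hev⟩ := eventually_coordJang_neg hmodel hτ0.le hm hC hK
  obtain ⟨ε', hε', hev'⟩ := eventually_coordJang_neg hmodel hτ0.le hm hC hK'
  obtain ⟨δ, hδ, hJ⟩ := eventually_sphereAtInfinity_iff.1 (hev.and hev')
  -- The conditions on `ρ₀`: the region lies where `u` is controlled, lies where the sign estimate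
  -- holds for both `K` and `-K`, and `ρ₀^τ` is small enough to absorb either tensor.
  have hsmall : ∀ᶠ s in 𝓝[>] (0 : ℝ), s < r ∧ s < δ ∧ s ^ τ < min ε ε' := by
    have h1 : Tendsto (fun s : ℝ => s ^ τ) (𝓝[>] 0) (𝓝 0) := by
      have := (Real.continuousAt_rpow_const 0 τ (Or.inr hτ0.le)).tendsto.mono_left
        (nhdsWithin_le_nhds (s := Ioi 0))
      rwa [Real.zero_rpow hτ0.ne'] at this
    filter_upwards [Ioo_mem_nhdsGT hr, Ioo_mem_nhdsGT hδ,
      h1.eventually_lt_const (lt_min hε hε')] with s h2 h3 h4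
    exact ⟨h2.2, h3.2, h4⟩
  obtain ⟨r₁, hr₁, hsm⟩ := (nhdsGT_basis (0 : ℝ)).eventually_iff.1 hsmall
  refine ⟨l, hl, r₁, hr₁, fun ρ₀ hρ₀ => ?_⟩
  obtain ⟨hρr, hρδ, hρε⟩ := hsm hρ₀
  have hρ := hρ₀.1
  set f : M → ℝ := fun p => profile a τ l ρ₀ (ballRho (c.Ψ p)) with hf
  set F : Euc n → ℝ := fun x => f (c.Ψ.symm x) with hF_def
  have hsub : rhoLT n ρ₀ ⊆ c.Ψ.target := fun x hx => hrc ⟨hx.1, hx.2.trans hρr⟩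
  have hF : EqOn F (fun x => profile a τ l ρ₀ (ballRho x)) (rhoLT n ρ₀) := fun x hx => by
    simp only [hF_def, hf, c.Ψ.right_inv (hsub hx)]
  have h₁ : ∀ s ∈ Ioo 0 ρ₀, HasDerivAt (profile a τ l ρ₀) (profileSlope a τ l ρ₀ s) s :=
    fun s hs => hasDerivAt_profile hl ha haτ hs
  have h₂ : ∀ s ∈ Ioo 0 ρ₀, HasDerivAt (profileSlope a τ l ρ₀) (profileSlope₁ a τ l ρ₀ s) s :=
    fun s hs => hasDerivAt_profileSlope hl ha haτ hs
  have htend : Tendsto (rhoDeriv F) (comap ballRho (𝓝[<] ρ₀)) atTop := by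
    refine ((tendsto_profileSlope hl ha haτ hρ).comp tendsto_comap).congr' ?_
    filter_upwards [preimage_mem_comap (Ioo_mem_nhdsLT hρ)] with x hx
    have hx' : x ∈ rhoLT n ρ₀ := ⟨ballRho_pos_iff.1 hx.1, hx.2⟩
    exact (rhoDeriv_radial h₁ hF hx' (c.ballRho_ne_zero_of_target (hsub hx'))).symm
  -- Stated for an arbitrary tensor `K'` and threshold `ε₀`, so that it serves `K` with `ε` and `-K`
  -- with `ε'`.
  have hjang : ∀ ε₀ ≥ min ε ε', ∀ K' : Euc n → Euc n →L[ℝ] Euc n →L[ℝ] ℝ, ∀ x ∈ rhoLT n ρ₀,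
      (∀ (f : Euc n → ℝ) (p q z : ℝ), 0 < p →
        (∀ i, pderiv i f x = p * -x i) →
        (∀ i j, pderiv i (pderiv j f) x = q / ballRho x * (x i * x j) - p * kron i j) →
        q = p * (1 + p ^ 2) * z → 0 ≤ z → z ≤ τ → z - n + p ^ 2 / (1 + p ^ 2) ≤ -m →
        ballRho x ^ τ ≤ ε₀ * (p / √(1 + p ^ 2)) → coordJang (c.push g) K' U f x < 0) →
      coordJang (c.push g) K' U F x < 0 := by
    intro ε₀ hε₀ K' x hx hcore
    have hs := ballRho_mem_Ioo hx
    have hp := profileSlope_pos hl ha haτ hs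
    have hD := one_pos.trans (one_lt_xiDen hl ha haτ hs)
    refine hcore F (profileSlope a τ l ρ₀ (ballRho x))
      (ballRho x * profileSlope₁ a τ l ρ₀ (ballRho x))
      (xiDen₁ a τ l ρ₀ (ballRho x) / xiDen a τ l ρ₀ (ballRho x)) hp
      (pderiv_radial h₁ hF hx) (fun i j => ?_) (mul_profileSlope₁ hl ha haτ hs)
      (div_nonneg (xiDen₁_nonneg hl (by linarith) haτ hρ hs.1) hD.le) ?_ ?_ ?_
    · rw [pderiv_pderiv_radial h₁ h₂ hF hx, mul_div_cancel_left₀ _ hs.1.ne']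
    · rw [div_le_iff₀ hD]
      exact xiDen₁_le hl haτ hρ hs.1
    · rw [← inv_xiDen_sq hl ha haτ hs]
      have := xiDen_ratio_bound hl ha haτ hs
      have h2a : 2 * a = n := by rw [ha_def]; ring
      rwa [← h2a]
    -- The smallness of `ρ₀^τ` replaces smallness of `ρ`: the bound `ρ^τ ≤ ρ₀^τ ξ` holds on the
    -- whole interval.
    · refine (rpow_le_profileSlope_div hl ha haτ hs).trans ?_
      gcongr
      exact hρε.le.trans hε₀
  refine ⟨fun x hx => ⟨hx.1, hx.2.trans_lt hρr⟩, f, fun p hp => ?_, fun p hp => ?_,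
    fun r' hr' => ?_, ⟨?_, ?_, htend, fun p hp => ?_⟩, ⟨?_, ?_, ?_, fun p hp => ?_⟩⟩
  · have := c.ballRho_mem_Ioc hp
    exact profile_eq hl ha haτ this.1 this.2
  · exact profile_pos hl ha haτ (ballRho_mem_Ioo (c.map_mem_rhoLT hp))
  · have hsub' : rhoLT n r' ⊆ rhoLT n ρ₀ := fun x hx => ⟨hx.1, hx.2.trans hr'.2⟩
    exact isWeightedHolder_profile hα hl ha haτ hr' (hF.mono hsub')
  · exact contMDiffOn_radial (contDiffOn_profile hl ha haτ)
  · exact continuousOn_radial (continuousOn_profile hl ha haτ hρ)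
  · have hx := c.map_mem_rhoLT hp
    exact hjang ε (min_le_left _ _) _ _ hx
      (hJ _ (ballRho_pos_iff.2 hx.1) (hx.2.trans hρδ)).1
  · exact contMDiffOn_radial (contDiffOn_profile hl ha haτ).neg
  · exact continuousOn_radial (continuousOn_profile hl ha haτ hρ).neg
  · refine (tendsto_neg_atTop_atBot.comp htend).congr fun x => ?_
    simp [rhoDeriv, F, fderiv_fun_neg]
  · have hx := c.map_mem_rhoLT hp
    have := hjang ε' (min_le_right _ _) _ _ hx
      (hJ _ (ballRho_pos_iff.2 hx.1) (hx.2.trans hρδ)).2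
    unfold jangOperator
    rw [coordJang_neg]
    exact neg_pos.2 this
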